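/- Let $d\ge 0$, let $S(q)=\sum_{m\ge 0}S^{a_1\dots a_m}q_{a_1}\cdots q_{a_m}$ be a formal power series in $q=(q_1,\dots,q_d)$ with real coefficients symmetric in their indices (repeated indices are summed), let $G:\mathbb{R}^d\to\mathbb{R}$ be smooth and let $\hbar>0$. Write $S_0$ for the constant term of $S$, $\varphi=(S^1,\dots,S^d)$ for the vector of linear coefficients, and $S^+(q)$ for the sum of the terms of degree $\ge 2$. **The integral.** The integral $$I(S,G)=\int Dy\,đq\;e^{\frac i\hbar (S(q)+G(y)-y^\alpha q_\alpha)},\qquad đq=(2\pi\hbar)^{-d}dq,$$ is understood formally: $e^{\frac i\hbar S^+(q)}=\sum_{n\ge0}P_n(q)$ is expanded into homogeneous polynomials $P_n$ of degree $n$ in $q$, and $I(S,G)$ is the formal series $\sum_n I_n t^n$ with $$I_n=\int Dy\,đq\;P_n(q)\,e^{\frac i\hbar (S_0+\varphi^\alpha q_\alpha+G(y)-y^\alpha q_\alpha)},$$ where $I_n$ is an oscillatory integral: one inserts $\chi(\varepsilon y)$, with $\chi$ smooth, compactly supported and equal to $1$ near $0$, integrates over $y$ and then over $q$, and lets $\varepsilon\to0^+$.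 The variable $t$ only records the degree in $q$ coming from $S^+$. **The graphs.** A bipartite multigraph $\gamma$ consists of finite sets $B_\gamma$ of black and $W_\gamma$ of white vertices and a finite multiset $E_\gamma$ of edges in $B_\gamma\times W_\gamma$. An isomorphism is a pair of bijections of the black and of the white vertices preserving the multiplicities of edges (parallel edges are not distinguished), and $\mathrm{sym}(\gamma)$ is the group of automorphisms. Let $[\Gamma^\circ]$ be the set of isomorphism classes of connected (hence nonempty) bipartite multigraphs without black vertices of degree $1$, where parallel edges are counted separately in degrees. Put $b_\gamma=|E_\gamma|-|B_\gamma|-|W_\gamma|+1$ and $$\langle S,G\rangle_\gamma=\Bigl(\prod_{v\in B_\gamma}\frac{m_v!}{(1!)^{k^v_1}\cdots(m_v!)^{k^v_{m_v}}}S^{e^v_1\dots e^v_{m_v}}\Bigr)\Bigl(\prod_{w\in W_\gamma}\frac{\partial}{\partial y^{e^w_1}}\cdots\frac{\partial}{\partial y^{e^w_{m_w}}}G(\varphi)\Bigr),$$ where $e^v_1,\dots,e^v_{m_v}$ are the edges at the vertex $v$, each edge serves as an index in $\{1,\dots,d\}$ that is summed over, and $k^v_i$ is the number of white vertices with which $v$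 shares exactly $i$ edges. **Claim.** For every $n$ there are only finitely many $\gamma\in[\Gamma^\circ]$ with $n$ edges, all the oscillatory integrals $I_n$ exist and do not depend on $\chi$, and $$I(S,G)=\exp\Bigl(\frac i\hbar\sum_{\gamma\in[\Gamma^\circ]}\frac{1}{|\mathrm{sym}(\gamma)|}\Bigl(\frac\hbar i\Bigr)^{b_\gamma}\langle S,G\rangle_\gamma\,t^{|E_\gamma|}\Bigr)$$ as formal power series in $t$ with complex coefficients. -/

import Mathlib

open scoped ContDiff Topology

noncomputable section

namespace QuantumThick

/-! ### Bipartite multigraphs -/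

/-- A bipartite multigraph with black vertices `Fin nB`, white vertices `Fin nW`, and `mult b w`
undistinguished edges between the black vertex `b` and the white vertex `w`. -/
structure BipGraph where
  nB : ℕ
  nW : ℕ
  mult : Fin nB → Fin nW → ℕ

namespace BipGraph

variable (γ : BipGraph)

/-- The edges of `γ`, listed with their multiplicities. -/
abbrev Edge : Type := (b : Fin γ.nB) × (w : Fin γ.nW) × Fin (γ.mult b w)

/-- The set `E_b` of edges at the black vertex `b`. -/
abbrev BlackEdge (b : Fin γ.nB) : Type := {e : γ.Edge // e.1 = b}

/-- The set `E_w` of edges at the white vertex `w`. -/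
abbrev WhiteEdge (w : Fin γ.nW) : Type := {e : γ.Edge // e.2.1 = w}

/-- The number of edges. -/
def numEdges : ℕ := Fintype.card γ.Edge

/-- The degree `m_b` of a black vertex, counting parallel edges separately. -/
def blackDeg (b : Fin γ.nB) : ℕ := Fintype.card (γ.BlackEdge b)

/-- The number `k^b_i` of white vertices with which the black vertex `b` shares exactly
`i` edges. -/
def sharing (b : Fin γ.nB) (i : ℕ) : ℕ :=
  (Finset.univ.filter fun w : Fin γ.nW => γ.mult b w = i).card

/-- The loop number `b_γ = |E| - |V| + 1`. -/
def loopNumber : ℤ := (γ.numEdges : ℤ) - ((γ.nB : ℤ) + (γ.nW : ℤ)) + 1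

/-- The simple graph on all the vertices in which two vertices are adjacent when some edge of `γ`
joins them. -/
def toSimpleGraph : SimpleGraph (Fin γ.nB ⊕ Fin γ.nW) :=
  SimpleGraph.fromRel fun x y => ∃ b w, x = Sum.inl b ∧ y = Sum.inr w ∧ 0 < γ.mult b w

/-- Connectedness (the graph without vertices is not connected). -/
def Connected : Prop := γ.toSimpleGraph.Connected

/-- All leaves, that is, all vertices of degree one, are white. -/
def WhiteLeaved : Prop := ∀ b, γ.blackDeg b ≠ 1

/-- Isomorphism: bijections of the black and of the white vertices that preserve the multiset of
edges. Parallel edges are not distinguished. -/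
def Iso (γ γ' : BipGraph) : Prop :=
  ∃ (σ : Fin γ.nB ≃ Fin γ'.nB) (τ : Fin γ.nW ≃ Fin γ'.nW),
    ∀ b w, γ'.mult (σ b) (τ w) = γ.mult b w

/-- The automorphism group `sym(γ)`. -/
def sym : Subgroup (Equiv.Perm (Fin γ.nB) × Equiv.Perm (Fin γ.nW)) where
  carrier := {p | ∀ b w, γ.mult (p.1 b) (p.2 w) = γ.mult b w}
  mul_mem' := by
    intro p p' hp hp' b w
    exact (hp _ _).trans (hp' b w)
  one_mem' := fun _ _ => rfl
  inv_mem' := by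
    intro p hp b w
    have h := hp (p.1.symm b) (p.2.symm w)
    rw [Equiv.apply_symm_apply, Equiv.apply_symm_apply] at h
    exact h.symm

end BipGraph

/-- The set `Γ°` of connected white-leaved bipartite multigraphs. -/
abbrev ConnWhiteLeaved : Type := {γ : BipGraph // γ.Connected ∧ γ.WhiteLeaved}

/-- Isomorphism as an equivalence relation on `Γ°`. -/
instance isoSetoid : Setoid ConnWhiteLeaved where
  r γ γ' := γ.1.Iso γ'.1
  iseqv :=
    { refl := fun _ => ⟨Equiv.refl _, Equiv.refl _, fun _ _ => rfl⟩
      symm := by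
        rintro γ γ' ⟨σ, τ, h⟩
        refine ⟨σ.symm, τ.symm, fun b w => ?_⟩
        have := h (σ.symm b) (τ.symm w)
        simp only [Equiv.apply_symm_apply] at this
        exact this.symm
      trans := by
        rintro γ γ' γ'' ⟨σ, τ, h⟩ ⟨σ', τ', h'⟩
        exact ⟨σ.trans σ', τ.trans τ', fun b w => (h' _ _).trans (h b w)⟩ }

/-- The set `[Γ°]` of isomorphism classes. -/
abbrev IsoClass : Type := Quotient isoSetoid

/-- A representative of an isomorphism class. -/
def IsoClass.rep (c : IsoClass) : BipGraph := (Quotient.out c).1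

/-! ### The terms of the expansion -/

/-- The formal power series `S(q) = ∑ₘ S^{a₁ … aₘ} q_{a₁} ⋯ q_{aₘ}` in `d` variables, given by its
coefficients. -/
abbrev Coeffs (d : ℕ) : Type := (m : ℕ) → (Fin m → Fin d) → ℝ

/-- The coefficients are symmetric in their indices. -/
def Coeffs.Symmetric {d : ℕ} (S : Coeffs d) : Prop :=
  ∀ (m : ℕ) (σ : Equiv.Perm (Fin m)) (a : Fin m → Fin d), S m (a ∘ σ) = S m a

/-- The constant term `S₀`. -/
def Coeffs.zeroth {d : ℕ} (S : Coeffs d) : ℝ := S 0 Fin.elim0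

/-- The vector `φ` of coefficients of the linear term of `S`. -/
def Coeffs.phi {d : ℕ} (S : Coeffs d) : EuclideanSpace ℝ (Fin d) :=
  WithLp.toLp 2 fun i => S 1 fun _ => i

/-- The iterated partial derivatives `∂_{a₁} ⋯ ∂_{aₘ} G (x)`. -/
def partials {d : ℕ} (G : EuclideanSpace ℝ (Fin d) → ℝ) (x : EuclideanSpace ℝ (Fin d)) : Coeffs d :=
  fun m a => iteratedFDeriv ℝ m G x fun j => EuclideanSpace.single (a j) 1

/-- The component `T^{e₁ … eₘ}` for a finite set `E = {e₁, …, eₘ}` of edges that carry the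
indices `a e`. For symmetric `T` the order of the edges does not matter. -/
def component {d : ℕ} (T : Coeffs d) {E : Type} [Fintype E] (a : E → Fin d) : ℝ :=
  T (Fintype.card E) fun j => a ((Fintype.equivFin E).symm j)

/-- The combinatorial factor `m! / ((1!)^{k₁} (2!)^{k₂} ⋯ (m!)^{kₘ})` of a black vertex of
degree `m`. -/
def blackFactor (γ : BipGraph) (b : Fin γ.nB) : ℝ :=
  ((γ.blackDeg b).factorial : ℝ) /
    ∏ i ∈ Finset.Icc 1 (γ.blackDeg b), (i.factorial : ℝ) ^ γ.sharing b i

/-- The term `⟨S, G⟩_γ`: every edge carries an index, which is summed over. -/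
def contraction {d : ℕ} (S : Coeffs d) (G : EuclideanSpace ℝ (Fin d) → ℝ) (γ : BipGraph) : ℝ :=
  ∑ a : γ.Edge → Fin d,
    (∏ b, blackFactor γ b * component S fun e : γ.BlackEdge b => a e.1) *
      ∏ w, component (partials G S.phi) fun e : γ.WhiteEdge w => a e.1

/-- `∑_{γ ∈ [Γ°]} (ħ/i)^{b_γ} ⟨S, G⟩_γ / |sym(γ)|` as a formal series, in which the power of the
variable records the number of edges, that is, the total degree in `q` of the factors
of `S` involved. -/
def graphSeries {d : ℕ} (S : Coeffs d) (G : EuclideanSpace ℝ (Fin d) → ℝ) (ħ : ℝ) :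
    PowerSeries ℂ :=
  PowerSeries.mk fun n =>
    ∑ᶠ c ∈ {c : IsoClass | c.rep.numEdges = n},
      ((ħ : ℂ) / Complex.I) ^ c.rep.loopNumber * (contraction S G c.rep : ℂ) /
        (Nat.card c.rep.sym : ℂ)

/-- The exponential of a formal power series with an arbitrary constant term. -/
def expSeries (X : PowerSeries ℂ) : PowerSeries ℂ :=
  Complex.exp (PowerSeries.constantCoeff X) •
    (PowerSeries.exp ℂ).subst (X - PowerSeries.C (PowerSeries.constantCoeff X))

/-! ### The formal integral -/

/-- `(i/ħ) S⁺(t q) = (i/ħ) ∑_{m ≥ 2} tᵐ S^{a₁ … aₘ} q_{a₁} ⋯ q_{aₘ}`, a series in `t` whose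
coefficients are polynomials in `q`. -/
def higherPart {d : ℕ} (S : Coeffs d) (ħ : ℝ) : PowerSeries (MvPolynomial (Fin d) ℂ) :=
  PowerSeries.mk fun m =>
    if 2 ≤ m then
      ∑ a : Fin m → Fin d,
        MvPolynomial.C (Complex.I / (ħ : ℂ) * (S m a : ℂ)) * ∏ j, MvPolynomial.X (a j)
    else 0

/-- The part of `exp ((i/ħ) S⁺(q))` that is homogeneous of degree `n` in `q`. -/
def amplitude {d : ℕ} (S : Coeffs d) (ħ : ℝ) (n : ℕ) : MvPolynomial (Fin d) ℂ :=
  PowerSeries.coeff n ((PowerSeries.exp ℂ).subst (higherPart S ħ))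

/-- A cutoff function: smooth, compactly supported, and equal to `1` near the origin. -/
structure IsCutoff {d : ℕ} (χ : EuclideanSpace ℝ (Fin d) → ℝ) : Prop where
  smooth : ContDiff ℝ ∞ χ
  compact : HasCompactSupport χ
  one_near : ∀ᶠ y in 𝓝 0, χ y = 1

/-- The integral over `y`, with the cutoff `χ(εy)`, of
`P(q) exp ((i/ħ) (S₀ + φⁱ qᵢ + G(y) - yⁱ qᵢ))`, as a function of `q`. -/
def innerIntegral {d : ℕ} (S : Coeffs d) (G : EuclideanSpace ℝ (Fin d) → ℝ) (ħ : ℝ)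
    (P : MvPolynomial (Fin d) ℂ) (χ : EuclideanSpace ℝ (Fin d) → ℝ) (ε : ℝ)
    (q : EuclideanSpace ℝ (Fin d)) : ℂ :=
  ∫ y : EuclideanSpace ℝ (Fin d), (χ (ε • y) : ℂ) * MvPolynomial.eval (fun i => (q i : ℂ)) P *
    Complex.exp (Complex.I / (ħ : ℂ) *
      ((S.zeroth + ∑ i, S.phi i * q i + G y - ∑ i, y i * q i : ℝ) : ℂ))

/-- `v` is the value of the oscillatory integral
`∫ Dy đq P(q) exp ((i/ħ) (S₀ + φⁱ qᵢ + G(y) - yⁱ qᵢ))` with `đq = (2πħ)^{-d} dq`: the limit of the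
regularized integrals as the cutoff is removed, whatever the cutoff function. -/
def HasOscIntegral {d : ℕ} (S : Coeffs d) (G : EuclideanSpace ℝ (Fin d) → ℝ) (ħ : ℝ)
    (P : MvPolynomial (Fin d) ℂ) (v : ℂ) : Prop :=
  ∀ χ : EuclideanSpace ℝ (Fin d) → ℝ, IsCutoff χ →
    (∀ ε : ℝ, 0 < ε → MeasureTheory.Integrable (innerIntegral S G ħ P χ ε)) ∧
      Filter.Tendsto
        (fun ε : ℝ => (((2 * Real.pi * ħ) ^ d : ℝ) : ℂ)⁻¹ *
          ∫ q : EuclideanSpace ℝ (Fin d), innerIntegral S G ħ P χ ε q)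
        (𝓝[>] 0) (𝓝 v)

/-- `J` is the formal integral `I(S, G) = ∫ Dy đq exp ((i/ħ) (S(q) + G(y) - yⁱ qᵢ))`. As `S` is a
formal power series, `exp ((i/ħ) S⁺(q))` is expanded in powers of `q` and integrated term by term;
the coefficient of `J` at `n` collects the terms of degree `n` in `q`. -/
def IsFormalIntegral {d : ℕ} (S : Coeffs d) (G : EuclideanSpace ℝ (Fin d) → ℝ) (ħ : ℝ)
    (J : PowerSeries ℂ) : Prop :=
  ∀ n : ℕ, HasOscIntegral S G ħ (amplitude S ħ n) (PowerSeries.coeff n J)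

/-- The formal integral is unique. -/
theorem IsFormalIntegral.unique {d : ℕ} {S : Coeffs d} {G : EuclideanSpace ℝ (Fin d) → ℝ} {ħ : ℝ}
    {J J' : PowerSeries ℂ} (h : IsFormalIntegral S G ħ J) (h' : IsFormalIntegral S G ħ J') :
    J = J' := by
  have f : ContDiffBump (0 : EuclideanSpace ℝ (Fin d)) := ⟨1, 2, one_pos, one_lt_two⟩
  have hf : IsCutoff (d := d) f := ⟨f.contDiff, f.hasCompactSupport, f.eventuallyEq_one⟩
  ext n
  exact tendsto_nhds_unique (h n f hf).2 (h' n f hf).2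

end QuantumThick

end

/-! By Fourier inversion, a factor `q_a` under the integral acts as `(ħ/i) ∂_a` on `exp ((i/ħ) G)`,
evaluated at `φ` (`hasOscIntegral_monomial`). Two expansions over set partitions then meet.
Expanding `exp ((i/ħ) S⁺)` in degree `n` partitions the `n` factors `q` into blocks of size at least
two, a block of size `m` carrying `m! (i/ħ) S^{a₁…aₘ}`, with an overall `1/n!` (`amplitude_eq`). Faà
di Bruno's formula for the `n` derivatives of `exp ((i/ħ) G)` gives a second partition, with block
weights `(i/ħ) ∂…∂G(φ)` (`listDeriv_cexp`). A pair of partitions of `{1, …, n}` is a bipartite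
multigraph with labelled edges: the blocks of the first partition are the black vertices, those of
the second the white ones.

The passage to connected graphs is the exponential formula. Splitting off the component of one edge
(`partSum_mul_partSum`) gives `A' = A C'` for the exponential generating functions of all and of
connected graphs (`derivative_labelSeries`), and this together with the constant coefficient
determines `A` (`powerSeries_ext_of_derivative`). The same mechanism with a single partition
computes the amplitudes.

It remains to forget labels. Labelling the vertices as well costs `k! l!`. A multiplicity matrix `μ`
comes from `n! / ∏ μ(b,w)!` pairs of maps on the edges (`card_mapsGraph_eq`); the `n!` cancels and
the `μ(b,w)!` are the denominators of the black factors. Each isomorphism class has `k! l! / |sym|`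
vertex labellings (`card_isomorphic_mul_card_sym`). With `ħ/i` per edge and `i/ħ` per vertex,
extracting one prefactor `i/ħ` leaves the exponent `b_γ`. The graphs without edges, the two isolated
vertices, supply `S₀ + G(φ)` and are treated apart. -/

open scoped ContDiff Topology

noncomputable section

namespace QuantumThick

open Finset

/-! ### Set partitions, pairs of partitions and their joint components -/

section SetPartitions

variable {α : Type*} [DecidableEq α] {R : Type*} [CommRing R]

/-- The set partitions of a finite set. -/
def setPartitions (s : Finset α) : Finset (Finset (Finset α)) :=
  s.powerset.powerset.filter fun P =>
    ∅ ∉ P ∧ (∀ b ∈ P, ∀ c ∈ P, b ≠ c → Disjoint b c) ∧ ∀ x ∈ s, ∃ b ∈ P, x ∈ b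

theorem mem_setPartitions {s : Finset α} {P : Finset (Finset α)} :
    P ∈ setPartitions s ↔ (∀ b ∈ P, b ⊆ s) ∧ ∅ ∉ P ∧
      (∀ b ∈ P, ∀ c ∈ P, b ≠ c → Disjoint b c) ∧ ∀ x ∈ s, ∃ b ∈ P, x ∈ b := by
  simp only [setPartitions, mem_filter, mem_powerset, Finset.subset_iff (s₁ := P)]

/-- The sum over the partitions of `s` of the products of the weights of the blocks. -/
def partSum (W : Finset α → R) (s : Finset α) : R :=
  ∑ P ∈ setPartitions s, ∏ b ∈ P, W b

theorem setPartitions_empty : setPartitions (∅ : Finset α) = {∅} := by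
  ext P
  simp only [mem_setPartitions, mem_singleton, subset_empty, notMem_empty, IsEmpty.forall_iff,
    implies_true, and_true]
  constructor
  · rintro ⟨h, h', -⟩
    refine eq_empty_of_forall_notMem fun b hb => h' ?_
    rwa [← h b hb]
  · rintro rfl
    simp

@[simp] theorem partSum_empty (W : Finset α → R) : partSum W ∅ = 1 := by
  simp [partSum, setPartitions_empty]

theorem erase_mem_setPartitions {s : Finset α} {P : Finset (Finset α)}
    (hP : P ∈ setPartitions s) {b : Finset α} (hb : b ∈ P) :
    P.erase b ∈ setPartitions (s \ b) := by
  rw [mem_setPartitions] at hP ⊢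
  obtain ⟨h1, h2, h3, h4⟩ := hP
  refine ⟨fun c hc => ?_, fun h => h2 (mem_of_mem_erase h), fun c hc c' hc' => ?_, fun x hx => ?_⟩
  · have hc' := mem_erase.1 hc
    rw [subset_sdiff]
    exact ⟨h1 c hc'.2, h3 c hc'.2 b hb hc'.1⟩
  · exact h3 c (mem_of_mem_erase hc) c' (mem_of_mem_erase hc')
  · rw [mem_sdiff] at hx
    obtain ⟨c, hc, hxc⟩ := h4 x hx.1
    exact ⟨c, mem_erase.2 ⟨fun h => hx.2 (h ▸ hxc), hc⟩, hxc⟩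

theorem insert_mem_setPartitions {s T : Finset α} {P : Finset (Finset α)} (hT : T ⊆ s)
    (hT' : T.Nonempty) (hP : P ∈ setPartitions (s \ T)) :
    T ∉ P ∧ insert T P ∈ setPartitions s := by
  rw [mem_setPartitions] at hP ⊢
  obtain ⟨h1, h2, h3, h4⟩ := hP
  have hd : ∀ b ∈ P, Disjoint b T := fun b hb => (subset_sdiff.1 (h1 b hb)).2
  refine ⟨fun h => ?_, fun b hb => ?_, fun h => ?_, fun b hb c hc hbc => ?_, fun x hx => ?_⟩
  · exact hT'.ne_empty (disjoint_self.1 (hd T h))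
  · rcases mem_insert.1 hb with rfl | hb
    · exact hT
    · exact (h1 b hb).trans sdiff_subset
  · rcases mem_insert.1 h with h | h
    · exact hT'.ne_empty h.symm
    · exact h2 h
  · rcases mem_insert.1 hb with rfl | hb <;> rcases mem_insert.1 hc with rfl | hc
    · exact absurd rfl hbc
    · exact (hd c hc).symm
    · exact hd b ‹_›
    · exact h3 b ‹_› c hc hbc
  · by_cases hxT : x ∈ T
    · exact ⟨T, mem_insert_self _ _, hxT⟩
    · obtain ⟨b, hb, hxb⟩ := h4 x (mem_sdiff.2 ⟨hx, hxT⟩)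
      exact ⟨b, mem_insert_of_mem hb, hxb⟩

/-- Summing over partitions with a distinguished block amounts to choosing the block and
partitioning the rest. -/
theorem sum_setPartitions_pointed (F W : Finset α → R) (s : Finset α) :
    ∑ P ∈ setPartitions s, ∑ b ∈ P, F b * ∏ c ∈ P.erase b, W c =
      ∑ T ∈ s.powerset with T.Nonempty, F T * partSum W (s \ T) := by
  simp only [partSum, mul_sum]
  rw [sum_sigma', sum_sigma']
  refine sum_bij' (fun x _ => ⟨x.2, x.1.erase x.2⟩) (fun x _ => ⟨insert x.1 x.2, x.1⟩)
    ?_ ?_ ?_ ?_ ?_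
  · rintro ⟨P, b⟩ h
    simp only [mem_sigma, mem_filter, mem_powerset] at h ⊢
    refine ⟨⟨(mem_setPartitions.1 h.1).1 b h.2, ?_⟩, erase_mem_setPartitions h.1 h.2⟩
    rw [nonempty_iff_ne_empty]
    rintro rfl
    exact (mem_setPartitions.1 h.1).2.1 h.2
  · rintro ⟨T, P⟩ h
    simp only [mem_sigma, mem_filter, mem_powerset] at h ⊢
    exact ⟨(insert_mem_setPartitions h.1.1 h.1.2 h.2).2, mem_insert_self _ _⟩
  · rintro ⟨P, b⟩ h
    simp only [mem_sigma] at h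
    simp [insert_erase h.2]
  · rintro ⟨T, P⟩ h
    simp only [mem_sigma, mem_filter, mem_powerset] at h
    simp [erase_insert (insert_mem_setPartitions h.1.1 h.1.2 h.2).1]
  · rintro ⟨P, b⟩ h
    rfl

/-- The recursion for sums over partitions, by the block of a given element. -/
theorem partSum_eq_sum_block (W : Finset α → R) {s : Finset α} {x : α} (hx : x ∈ s) :
    partSum W s = ∑ T ∈ s.powerset with x ∈ T, W T * partSum W (s \ T) := by
  -- Exactly one block of each partition contains `x`, so restricting the marked weight to blocks
  -- through `x` recovers each product once.
  have key := sum_setPartitions_pointed (fun b => if x ∈ b then W b else 0) W s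
  have h1 : ∀ P ∈ setPartitions s,
      ∑ b ∈ P, (if x ∈ b then W b else 0) * ∏ c ∈ P.erase b, W c = ∏ b ∈ P, W b := by
    intro P hP
    obtain ⟨-, -, h3, h4⟩ := mem_setPartitions.1 hP
    obtain ⟨b, hb, hxb⟩ := h4 x hx
    rw [sum_eq_single_of_mem b hb, if_pos hxb, mul_prod_erase P W hb]
    intro c hc hcb
    rw [if_neg, zero_mul]
    exact fun hxc => (disjoint_left.1 (h3 c hc b hb hcb)) hxc hxb
  rw [sum_congr rfl h1] at key
  rw [partSum, key]
  simp only [ite_mul, zero_mul]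
  rw [← sum_filter, filter_filter]
  refine sum_congr (filter_congr fun T _ => ⟨fun h => h.2, fun h => ⟨⟨x, h⟩, h⟩⟩) fun _ _ => rfl

theorem sum_powerset_insert_filter_mem {M : Type*} [AddCommMonoid M] (f : Finset α → M)
    {s : Finset α} {x : α} (hx : x ∉ s) :
    ∑ T ∈ (insert x s).powerset with x ∈ T, f T = ∑ T ∈ s.powerset, f (insert x T) := by
  refine sum_bij' (fun T _ => T.erase x) (fun T _ => insert x T) ?_ ?_ ?_ ?_ ?_
  · intro T hT
    rw [mem_filter, mem_powerset] at hT
    rw [mem_powerset]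
    exact (erase_subset_erase x hT.1).trans (by rw [erase_insert hx])
  · intro T hT
    rw [mem_powerset] at hT
    rw [mem_filter, mem_powerset]
    exact ⟨insert_subset_insert x hT, mem_insert_self _ _⟩
  · intro T hT
    exact insert_erase (mem_filter.1 hT).2
  · intro T hT
    exact erase_insert fun h => hx (mem_powerset.1 hT h)
  · intro T hT
    rw [insert_erase (mem_filter.1 hT).2]

/-- The shape matching the product rule in Faà di Bruno's formula: the new element either forms a
block by itself (`T = ∅`) or joins an old block `T`. -/
theorem partSum_insert (W : Finset α → R) {s : Finset α} {x : α} (hx : x ∉ s) :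
    partSum W (insert x s) = ∑ T ∈ s.powerset, W (insert x T) * partSum W (s \ T) := by
  rw [partSum_eq_sum_block W (mem_insert_self x s), sum_powerset_insert_filter_mem _ hx]
  refine sum_congr rfl fun T hT => ?_
  rw [insert_sdiff_insert, sdiff_insert_of_notMem hx]

/-- `T` is a union of blocks of the partition `P`, up to elements outside the blocks. -/
def Saturated (P : Finset (Finset α)) (T : Finset α) : Prop :=
  ∀ b ∈ P, b ⊆ T ∨ Disjoint b T

/-- Two partitions of `s` are jointly connected if no proper nonempty subset of `s` is saturated
for both of them. -/
def JointlyConnected (s : Finset α) (P Q : Finset (Finset α)) : Prop :=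
  ∀ T ⊆ s, T.Nonempty → Saturated P T → Saturated Q T → T = s

open Classical in
/-- The jointly connected pairs of partitions of `s`. -/
def connPairs (s : Finset α) : Finset (Finset (Finset α) × Finset (Finset α)) :=
  (setPartitions s ×ˢ setPartitions s).filter fun p => JointlyConnected s p.1 p.2

/-- The sum over the jointly connected pairs of partitions of the products of weights of blocks. -/
def connSum (W V : Finset α → R) (s : Finset α) : R :=
  ∑ p ∈ connPairs s, (∏ b ∈ p.1, W b) * ∏ b ∈ p.2, V b

/-- The blocks of `Q` are nonempty and disjoint from `T`, so inclusion in `T` tells the two families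
apart after gluing. This makes gluing and splitting along a saturated set inverse to each other. -/
theorem setPartitions_glue {s T : Finset α} {P Q : Finset (Finset α)} (hT : T ⊆ s)
    (hP : P ∈ setPartitions T) (hQ : Q ∈ setPartitions (s \ T)) :
    P ∪ Q ∈ setPartitions s ∧ Disjoint P Q ∧ (P ∪ Q).filter (· ⊆ T) = P ∧
      (P ∪ Q).filter (¬ · ⊆ T) = Q ∧ Saturated (P ∪ Q) T := by
  obtain ⟨h1, h2, h3, h4⟩ := mem_setPartitions.1 hP
  obtain ⟨k1, k2, k3, k4⟩ := mem_setPartitions.1 hQ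
  have hd : ∀ b ∈ Q, Disjoint b T := fun b hb => (subset_sdiff.1 (k1 b hb)).2
  have hn : ∀ b ∈ Q, ¬ b ⊆ T := fun b hb h => by
    have := disjoint_self.1 ((hd b hb).mono_right h)
    exact k2 (by rw [← bot_eq_empty, ← this]; exact hb)
  refine ⟨mem_setPartitions.2 ⟨?_, ?_, ?_, ?_⟩, ?_, ?_, ?_, ?_⟩
  · intro b hb
    rcases mem_union.1 hb with hb | hb
    · exact (h1 b hb).trans hT
    · exact (k1 b hb).trans sdiff_subset
  · intro h
    rcases mem_union.1 h with h | h
    · exact h2 h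
    · exact k2 h
  · intro b hb c hc hbc
    rcases mem_union.1 hb with hb | hb <;> rcases mem_union.1 hc with hc | hc
    · exact h3 b hb c hc hbc
    · exact ((hd c hc).mono_right (h1 b hb)).symm
    · exact (hd b hb).mono_right (h1 c hc)
    · exact k3 b hb c hc hbc
  · intro x hx
    by_cases hxT : x ∈ T
    · obtain ⟨b, hb, hxb⟩ := h4 x hxT
      exact ⟨b, mem_union_left _ hb, hxb⟩
    · obtain ⟨b, hb, hxb⟩ := k4 x (mem_sdiff.2 ⟨hx, hxT⟩)
      exact ⟨b, mem_union_right _ hb, hxb⟩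
  · exact disjoint_left.2 fun b hb hb' => hn b hb' (h1 b hb)
  · rw [filter_union, filter_true_of_mem h1, filter_false_of_mem hn, union_empty]
  · rw [filter_union, filter_true_of_mem hn, filter_false_of_mem fun b hb => not_not.2 (h1 b hb),
      empty_union]
  · intro b hb
    rcases mem_union.1 hb with hb | hb
    · exact Or.inl (h1 b hb)
    · exact Or.inr (hd b hb)

theorem setPartitions_split {s T : Finset α} {P : Finset (Finset α)} (hT : T ⊆ s)
    (hP : P ∈ setPartitions s) (hPT : Saturated P T) :
    P.filter (· ⊆ T) ∈ setPartitions T ∧ P.filter (¬ · ⊆ T) ∈ setPartitions (s \ T) := by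
  obtain ⟨h1, h2, h3, h4⟩ := mem_setPartitions.1 hP
  refine ⟨mem_setPartitions.2 ⟨fun b hb => (mem_filter.1 hb).2, fun h => h2 (mem_filter.1 h).1,
    fun b hb c hc => h3 b (mem_filter.1 hb).1 c (mem_filter.1 hc).1, fun x hx => ?_⟩,
    mem_setPartitions.2 ⟨fun b hb => ?_, fun h => h2 (mem_filter.1 h).1,
    fun b hb c hc => h3 b (mem_filter.1 hb).1 c (mem_filter.1 hc).1, fun x hx => ?_⟩⟩
  · obtain ⟨b, hb, hxb⟩ := h4 x (hT hx)
    refine ⟨b, mem_filter.2 ⟨hb, (hPT b hb).resolve_right fun h => ?_⟩, hxb⟩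
    exact disjoint_left.1 h hxb hx
  · obtain ⟨hb, hb'⟩ := mem_filter.1 hb
    exact subset_sdiff.2 ⟨h1 b hb, (hPT b hb).resolve_left hb'⟩
  · obtain ⟨hx, hxT⟩ := mem_sdiff.1 hx
    obtain ⟨b, hb, hxb⟩ := h4 x hx
    exact ⟨b, mem_filter.2 ⟨hb, fun h => hxT (h hxb)⟩, hxb⟩

/-- The discarded blocks are disjoint from `T`, hence from `U`, and impose no condition. -/
theorem saturated_filter_iff {T U : Finset α} {P : Finset (Finset α)} (hPT : Saturated P T)
    (hU : U ⊆ T) : Saturated (P.filter (· ⊆ T)) U ↔ Saturated P U := by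
  refine ⟨fun h b hb => ?_, fun h b hb => h b (mem_filter.1 hb).1⟩
  rcases hPT b hb with hbT | hbT
  · exact h b (mem_filter.2 ⟨hb, hbT⟩)
  · exact Or.inr (hbT.mono_right hU)

open Classical in
/-- The smallest subset of `s` that contains `x` and is saturated for both partitions. -/
def jointComponent (s : Finset α) (P Q : Finset (Finset α)) (x : α) : Finset α :=
  s.filter fun y => ∀ T ⊆ s, x ∈ T → Saturated P T → Saturated Q T → y ∈ T

theorem mem_jointComponent {s : Finset α} {P Q : Finset (Finset α)} {x y : α} :
    y ∈ jointComponent s P Q x ↔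
      y ∈ s ∧ ∀ T ⊆ s, x ∈ T → Saturated P T → Saturated Q T → y ∈ T := by
  simp only [jointComponent, mem_filter]

theorem jointComponent_subset_self (s : Finset α) (P Q : Finset (Finset α)) (x : α) :
    jointComponent s P Q x ⊆ s :=
  fun _ hy => (mem_jointComponent.1 hy).1

theorem jointComponent_subset {s T : Finset α} {P Q : Finset (Finset α)} {x : α} (hT : T ⊆ s)
    (hx : x ∈ T) (hP : Saturated P T) (hQ : Saturated Q T) : jointComponent s P Q x ⊆ T :=
  fun _ hy => (mem_jointComponent.1 hy).2 T hT hx hP hQ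

theorem mem_jointComponent_self {s : Finset α} {P Q : Finset (Finset α)} {x : α} (hx : x ∈ s) :
    x ∈ jointComponent s P Q x :=
  mem_jointComponent.2 ⟨hx, fun _ _ h _ _ => h⟩

/-- If a block meets the component at `y`, every saturated set through `x` contains `y` and
therefore the whole block. -/
theorem saturated_jointComponent {s : Finset α} {P Q : Finset (Finset α)} {x : α}
    (hP : P ∈ setPartitions s) (hQ : Q ∈ setPartitions s) :
    Saturated P (jointComponent s P Q x) ∧ Saturated Q (jointComponent s P Q x) := by
  constructor
  all_goals
    intro b hb
    by_cases h : Disjoint b (jointComponent s P Q x)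
    · exact Or.inr h
    left
    obtain ⟨y, hyb, hy⟩ := not_disjoint_iff.1 h
    intro z hz
  · refine mem_jointComponent.2 ⟨(mem_setPartitions.1 hP).1 b hb hz, fun T hT hx hPT hQT => ?_⟩
    have hyT := (mem_jointComponent.1 hy).2 T hT hx hPT hQT
    exact (hPT b hb).resolve_right (fun h => disjoint_left.1 h hyb hyT) hz
  · refine mem_jointComponent.2 ⟨(mem_setPartitions.1 hQ).1 b hb hz, fun T hT hx hPT hQT => ?_⟩
    have hyT := (mem_jointComponent.1 hy).2 T hT hx hPT hQT
    exact (hQT b hb).resolve_right (fun h => disjoint_left.1 h hyb hyT) hz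

/-- A saturated `U` inside the component that misses `x` would have a saturated complement through
`x`; by minimality that complement contains the component, and `U` is empty. -/
theorem jointlyConnected_jointComponent {s : Finset α} {P Q : Finset (Finset α)} {x : α}
    (hx : x ∈ s) (hP : P ∈ setPartitions s) (hQ : Q ∈ setPartitions s) :
    JointlyConnected (jointComponent s P Q x) (P.filter (· ⊆ jointComponent s P Q x))
      (Q.filter (· ⊆ jointComponent s P Q x)) := by
  intro U hU hne hPU hQU
  obtain ⟨sP, sQ⟩ := saturated_jointComponent (x := x) hP hQ
  have hCs : jointComponent s P Q x ⊆ s := jointComponent_subset_self s P Q x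
  rw [saturated_filter_iff sP hU] at hPU
  rw [saturated_filter_iff sQ hU] at hQU
  refine subset_antisymm hU ?_
  by_cases hxU : x ∈ U
  · exact jointComponent_subset (hU.trans hCs) hxU hPU hQU
  · exfalso
    have hdiff : ∀ {P : Finset (Finset α)}, P ∈ setPartitions s → Saturated P U →
        Saturated P (s \ U) := by
      intro P hP h b hb
      rcases h b hb with h | h
      · exact Or.inr (disjoint_sdiff.mono_left h)
      · exact Or.inl (subset_sdiff.2 ⟨(mem_setPartitions.1 hP).1 b hb, h⟩)
    have := jointComponent_subset sdiff_subset (mem_sdiff.2 ⟨hx, hxU⟩) (hdiff hP hPU)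
      (hdiff hQ hQU)
    obtain ⟨y, hy⟩ := hne
    exact (mem_sdiff.1 (this (hU hy))).2 hy

/-- Uniqueness of the splitting: after gluing a connected pair on `T` to any pair on the rest, `T`
can be read off as the component of `x`. -/
theorem jointComponent_eq {s T : Finset α} {P Q : Finset (Finset α)} {x : α} (hT : T ⊆ s)
    (hxT : x ∈ T) (hP : P ∈ setPartitions s) (hQ : Q ∈ setPartitions s) (hPT : Saturated P T)
    (hQT : Saturated Q T)
    (hc : JointlyConnected T (P.filter (· ⊆ T)) (Q.filter (· ⊆ T))) :
    jointComponent s P Q x = T := by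
  have hsub := jointComponent_subset hT hxT hPT hQT
  obtain ⟨sP, sQ⟩ := saturated_jointComponent (x := x) hP hQ
  exact hc _ hsub ⟨x, mem_jointComponent_self (hT hxT)⟩ ((saturated_filter_iff hPT hsub).2 sP)
    ((saturated_filter_iff hQT hsub).2 sQ)

/-- The sum over all pairs of partitions, by the joint component of a given element. -/
theorem partSum_mul_partSum (W V : Finset α → R) {s : Finset α} {x : α} (hx : x ∈ s) :
    partSum W s * partSum V s = ∑ T ∈ s.powerset with x ∈ T,
      connSum W V T * (partSum W (s \ T) * partSum V (s \ T)) := by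
  simp only [partSum, connSum, sum_mul_sum, ← sum_product']
  rw [sum_sigma']
  symm
  -- Gluing in one direction; in the other, cutting both partitions along the joint component of
  -- `x`.
  refine sum_bij' (fun z _ => (z.2.1.1 ∪ z.2.2.1, z.2.1.2 ∪ z.2.2.2))
    (fun p _ => ⟨jointComponent s p.1 p.2 x,
      (p.1.filter (· ⊆ jointComponent s p.1 p.2 x), p.2.filter (· ⊆ jointComponent s p.1 p.2 x)),
      (p.1.filter (¬ · ⊆ jointComponent s p.1 p.2 x),
        p.2.filter (¬ · ⊆ jointComponent s p.1 p.2 x))⟩) ?_ ?_ ?_ ?_ ?_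
  · rintro ⟨T, ⟨P1, Q1⟩, ⟨P2, Q2⟩⟩ h
    simp only [mem_sigma, mem_filter, mem_powerset, mem_product, connPairs] at h ⊢
    obtain ⟨⟨hT, hxT⟩, ⟨⟨hP1, hQ1⟩, hc⟩, hP2, hQ2⟩ := h
    exact ⟨(setPartitions_glue hT hP1 hP2).1, (setPartitions_glue hT hQ1 hQ2).1⟩
  · rintro ⟨P, Q⟩ h
    simp only [mem_sigma, mem_filter, mem_powerset, mem_product, connPairs] at h ⊢
    obtain ⟨hP, hQ⟩ := h
    obtain ⟨sP, sQ⟩ := saturated_jointComponent (x := x) hP hQ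
    have hCs : jointComponent s P Q x ⊆ s := jointComponent_subset_self s P Q x
    obtain ⟨a1, a2⟩ := setPartitions_split hCs hP sP
    obtain ⟨b1, b2⟩ := setPartitions_split hCs hQ sQ
    exact ⟨⟨hCs, mem_jointComponent_self hx⟩, ⟨⟨a1, b1⟩,
      jointlyConnected_jointComponent hx hP hQ⟩, a2, b2⟩
  · rintro ⟨T, ⟨P1, Q1⟩, ⟨P2, Q2⟩⟩ h
    simp only [mem_sigma, mem_filter, mem_powerset, mem_product, connPairs] at h
    obtain ⟨⟨hT, hxT⟩, ⟨⟨hP1, hQ1⟩, hc⟩, hP2, hQ2⟩ := h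
    obtain ⟨a1, a2, a3, a4, a5⟩ := setPartitions_glue hT hP1 hP2
    obtain ⟨b1, b2, b3, b4, b5⟩ := setPartitions_glue hT hQ1 hQ2
    have hC : jointComponent s (P1 ∪ P2) (Q1 ∪ Q2) x = T :=
      jointComponent_eq hT hxT a1 b1 a5 b5 (by rwa [a3, b3])
    simp only [hC, a3, a4, b3, b4]
  · rintro ⟨P, Q⟩ h
    simp only [filter_union_filter_not_eq]
  · rintro ⟨T, ⟨P1, Q1⟩, ⟨P2, Q2⟩⟩ h
    simp only [mem_sigma, mem_filter, mem_powerset, mem_product, connPairs] at h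
    obtain ⟨⟨hT, hxT⟩, ⟨⟨hP1, hQ1⟩, hc⟩, hP2, hQ2⟩ := h
    obtain ⟨a1, a2, a3, a4, a5⟩ := setPartitions_glue hT hP1 hP2
    obtain ⟨b1, b2, b3, b4, b5⟩ := setPartitions_glue hT hQ1 hQ2
    simp only [prod_union a2, prod_union b2]
    ring

end SetPartitions

/-! ### Invariance of partition sums under injections of the index set -/

section Transport

variable {α β : Type*} [DecidableEq α] [DecidableEq β] {R : Type*} [CommRing R]

theorem sum_powerset_map_filter_mem {M : Type*} [AddCommMonoid M] (e : α ↪ β)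
    (f : Finset β → M) (s : Finset α) (x : α) :
    ∑ T ∈ (s.map e).powerset with e x ∈ T, f T = ∑ T ∈ s.powerset with x ∈ T, f (T.map e) := by
  symm
  refine sum_bij (fun T _ => T.map e) ?_ ?_ ?_ ?_
  · intro T hT
    rw [mem_filter, mem_powerset] at hT ⊢
    exact ⟨map_subset_map.2 hT.1, mem_map_of_mem e hT.2⟩
  · intro T _ T' _ h
    exact map_injective e h
  · intro T hT
    rw [mem_filter, mem_powerset, subset_map_iff] at hT
    obtain ⟨⟨u, hu, rfl⟩, hx⟩ := hT
    exact ⟨u, mem_filter.2 ⟨mem_powerset.2 hu, (mem_map' e).1 hx⟩, rfl⟩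
  · intro T _
    rfl

theorem sdiff_map (e : α ↪ β) (s T : Finset α) : s.map e \ T.map e = (s \ T).map e := by
  ext y
  simp only [mem_sdiff, mem_map]
  constructor
  · rintro ⟨⟨x, hx, rfl⟩, h⟩
    exact ⟨x, ⟨hx, fun h' => h ⟨x, h', rfl⟩⟩, rfl⟩
  · rintro ⟨x, ⟨hx, hx'⟩, rfl⟩
    exact ⟨⟨x, hx, rfl⟩, fun ⟨z, hz, h⟩ => hx' (e.injective h ▸ hz)⟩

/-- Both sides obey the recursion on the block of one element, which avoids transporting the
partitions themselves. -/
theorem partSum_map (e : α ↪ β) (W : Finset β → R) (s : Finset α) :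
    partSum (fun T => W (T.map e)) s = partSum W (s.map e) := by
  induction s using Finset.strongInduction with
  | H s ih =>
    rcases s.eq_empty_or_nonempty with rfl | ⟨x, hx⟩
    · simp
    rw [partSum_eq_sum_block _ hx, partSum_eq_sum_block W (mem_map_of_mem e hx),
      sum_powerset_map_filter_mem]
    refine sum_congr rfl fun T hT => ?_
    rw [mem_filter, mem_powerset] at hT
    rw [sdiff_map, ih _ (sdiff_ssubset hT.1 ⟨x, hT.2⟩)]

@[simp] theorem connSum_empty (W V : Finset α → R) : connSum W V ∅ = 1 := by
  have : connPairs (∅ : Finset α) = {(∅, ∅)} := by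
    ext ⟨P, Q⟩
    simp only [connPairs, mem_filter, setPartitions_empty, mem_product, mem_singleton,
      Prod.mk.injEq, and_iff_left_iff_imp]
    intro _ T hT _ _ _
    exact subset_empty.1 hT
  simp [connSum, this]

/-- The component recursion can be solved for the term `T = s`, whose cofactor is `1`; all other
terms involve proper subsets and agree by induction. -/
theorem connSum_map (e : α ↪ β) (W V : Finset β → R) (s : Finset α) :
    connSum (fun T => W (T.map e)) (fun T => V (T.map e)) s = connSum W V (s.map e) := by
  induction s using Finset.strongInduction with
  | H s ih =>
    rcases s.eq_empty_or_nonempty with rfl | ⟨x, hx⟩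
    · simp
    have h1 := partSum_mul_partSum (fun T => W (T.map e)) (fun T => V (T.map e)) hx
    have h2 := partSum_mul_partSum W V (mem_map_of_mem e hx)
    rw [sum_powerset_map_filter_mem] at h2
    simp only [partSum_map, sdiff_map] at h1 h2
    rw [h1] at h2
    have hs : s ∈ s.powerset.filter (x ∈ ·) := mem_filter.2 ⟨mem_powerset_self s, hx⟩
    rw [← add_sum_erase _ _ hs, ← add_sum_erase _ _ hs] at h2
    have h3 : ∀ T ∈ (s.powerset.filter (x ∈ ·)).erase s,
        connSum (fun T => W (T.map e)) (fun T => V (T.map e)) T *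
          (partSum W ((s \ T).map e) * partSum V ((s \ T).map e)) =
        connSum W V (T.map e) * (partSum W ((s \ T).map e) * partSum V ((s \ T).map e)) := by
      intro T hT
      rw [mem_erase, mem_filter, mem_powerset] at hT
      rw [ih T (hT.2.1.ssubset_of_ne hT.1)]
    rw [sum_congr rfl h3] at h2
    simpa using h2

end Transport

/-! ### Exponential generating functions of sums over labellings -/

section Averages

variable {ι : Type*} {R : Type*} [CommRing R]

/-- A family of functions of the subsets of index sets decorated with labels in `ι` is natural
if it is compatible with injections of the index sets. -/
def Natural (F : (n : ℕ) → (Fin n → ι) → Finset (Fin n) → R) : Prop :=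
  ∀ ⦃k n : ℕ⦄ (e : Fin k ↪ Fin n) (a : Fin n → ι) (s : Finset (Fin k)),
    F k (a ∘ e) s = F n a (s.map e)

theorem Natural.partSum {W : (n : ℕ) → (Fin n → ι) → Finset (Fin n) → R} (hW : Natural W) :
    Natural fun n a => partSum (W n a) := by
  intro k n e a s
  have : W k (a ∘ e) = fun T => W n a (T.map e) := funext fun T => hW e a T
  simp only [this, partSum_map]

theorem Natural.connSum {W V : (n : ℕ) → (Fin n → ι) → Finset (Fin n) → R} (hW : Natural W)
    (hV : Natural V) : Natural fun n a => connSum (W n a) (V n a) := by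
  intro k n e a s
  have h1 : W k (a ∘ e) = fun T => W n a (T.map e) := funext fun T => hW e a T
  have h2 : V k (a ∘ e) = fun T => V n a (T.map e) := funext fun T => hV e a T
  simp only [h1, h2, connSum_map]

theorem Natural.mul {W V : (n : ℕ) → (Fin n → ι) → Finset (Fin n) → R} (hW : Natural W)
    (hV : Natural V) : Natural fun n a s => W n a s * V n a s := by
  intro k n e a s
  simp only [hW e a s, hV e a s]

variable [Fintype ι]

/-- The sum over all labellings of an index set of size `n`. -/
def labelSum (F : (n : ℕ) → (Fin n → ι) → Finset (Fin n) → R) (n : ℕ) : R :=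
  ∑ a : Fin n → ι, F n a univ

/-- A labelling is an independent choice on `T` and on its complement; by naturality each factor
sees only the labels on its own part, so the sum factors and only the cardinalities remain. -/
theorem sum_mul_compl_eq {V U : (n : ℕ) → (Fin n → ι) → Finset (Fin n) → R} (hV : Natural V)
    (hU : Natural U) {n : ℕ} (T : Finset (Fin n)) :
    ∑ a : Fin n → ι, V n a T * U n a Tᶜ = labelSum V #T * labelSum U (n - #T) := by
  have hc : #Tᶜ = n - #T := by rw [card_compl, Fintype.card_fin]
  let E : Fin #T ⊕ Fin (n - #T) ≃ Fin n := finSumEquivOfFinset rfl hc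
  let e₁ : Fin #T ↪ Fin n := (T.orderEmbOfFin rfl).toEmbedding
  let e₂ : Fin (n - #T) ↪ Fin n := (Tᶜ.orderEmbOfFin hc).toEmbedding
  have h1 : univ.map e₁ = T := map_orderEmbOfFin_univ T rfl
  have h2 : univ.map e₂ = Tᶜ := map_orderEmbOfFin_univ Tᶜ hc
  rw [labelSum, labelSum, sum_mul_sum, ← sum_product', univ_product_univ]
  refine Fintype.sum_equiv
    ((E.arrowCongr (Equiv.refl ι)).symm.trans (Equiv.sumArrowEquivProdArrow _ _ _)) _ _ ?_
  intro a
  conv_lhs => rw [← h2]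
  conv_lhs => enter [1]; rw [← h1]
  rw [← hV e₁ a, ← hU e₂ a]
  rfl

/-- The recursion for sums over labellings. -/
theorem labelSum_succ {V U : (n : ℕ) → (Fin n → ι) → Finset (Fin n) → R} (hV : Natural V)
    (hU : Natural U)
    (h : ∀ (n : ℕ) (a : Fin (n + 1) → ι),
      U (n + 1) a univ = ∑ T ∈ univ.powerset with 0 ∈ T, V (n + 1) a T * U (n + 1) a (univ \ T))
    (n : ℕ) :
    labelSum U (n + 1) = ∑ k ∈ range (n + 1),
      n.choose k • (labelSum V (k + 1) * labelSum U (n - k)) := by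
  rw [labelSum]
  simp only [h, ← compl_eq_univ_sdiff]
  rw [sum_comm]
  simp only [sum_mul_compl_eq hV hU]
  rw [← insert_erase (mem_univ (0 : Fin (n + 1))),
    sum_powerset_insert_filter_mem _ (notMem_erase 0 univ)]
  have hcard : #((univ : Finset (Fin (n + 1))).erase 0) = n := by
    rw [card_erase_of_mem (mem_univ _), card_univ, Fintype.card_fin, Nat.add_sub_cancel]
  have := sum_powerset_apply_card (fun k => labelSum V (k + 1) * labelSum U (n - k))
    (x := (univ : Finset (Fin (n + 1))).erase 0)
  rw [hcard] at this
  rw [← this]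
  refine sum_congr rfl fun T hT => ?_
  rw [card_insert_of_notMem fun h0 => (mem_erase.1 (mem_powerset.1 hT h0)).1 rfl,
    Nat.add_sub_add_right]

variable [Algebra ℚ R]

/-- The exponential generating function of the sums over labellings. -/
def labelSeries (F : (n : ℕ) → (Fin n → ι) → Finset (Fin n) → R) : PowerSeries R :=
  PowerSeries.mk fun n => (n.factorial : ℚ)⁻¹ • labelSum F n

/-- The exponential formula in differential form. The part `T` contains the distinguished index `0`,
so only its other `k` elements are chosen freely among `n`; this shift of degree is what the
derivative records. -/
theorem derivative_labelSeries {V U : (n : ℕ) → (Fin n → ι) → Finset (Fin n) → R}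
    (hV : Natural V) (hU : Natural U)
    (h : ∀ (n : ℕ) (a : Fin (n + 1) → ι),
      U (n + 1) a univ = ∑ T ∈ univ.powerset with 0 ∈ T, V (n + 1) a T * U (n + 1) a (univ \ T)) :
    PowerSeries.derivative R (labelSeries U) =
      labelSeries U * PowerSeries.derivative R (labelSeries V) := by
  ext n
  rw [mul_comm, PowerSeries.coeff_mul, Nat.sum_antidiagonal_eq_sum_range_succ_mk]
  simp only [PowerSeries.coeff_derivative, labelSeries, PowerSeries.coeff_mk]
  have hf : ∀ (m : ℕ) (y : R), (((m + 1).factorial : ℚ)⁻¹ • y) * ((m : R) + 1) =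
      (m.factorial : ℚ)⁻¹ • y := by
    intro m y
    have h1 : ((m : R) + 1) = algebraMap ℚ R ((m : ℚ) + 1) := by simp
    rw [h1, mul_comm, ← Algebra.smul_def, smul_smul]
    congr 1
    have : (m.factorial : ℚ) ≠ 0 := by positivity
    have : (m : ℚ) + 1 ≠ 0 := by positivity
    push_cast [Nat.factorial_succ]
    field_simp
  rw [hf, labelSum_succ hV hU h, smul_sum]
  refine sum_congr rfl fun k hk => ?_
  have hkn : k ≤ n := Nat.lt_succ_iff.1 (mem_range.1 hk)
  rw [hf, smul_mul_smul_comm, ← Nat.cast_smul_eq_nsmul ℚ, smul_smul]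
  congr 1
  rw [Nat.cast_choose ℚ hkn]
  have : (n.factorial : ℚ) ≠ 0 := by positivity
  have : (k.factorial : ℚ) ≠ 0 := by positivity
  have : ((n - k).factorial : ℚ) ≠ 0 := by positivity
  field_simp

end Averages

/-! ### Power series determined by their logarithmic derivative -/

section Series

variable {R : Type*} [CommRing R]

theorem constantCoeff_exp_subst [Algebra ℂ R] {X : PowerSeries R} (hX : PowerSeries.constantCoeff X = 0) :
    PowerSeries.constantCoeff ((PowerSeries.exp ℂ).subst X : PowerSeries R) = 1 := by
  have hs : PowerSeries.HasSubst X := PowerSeries.HasSubst.of_constantCoeff_zero' hX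
  rw [← PowerSeries.coeff_zero_eq_constantCoeff_apply, PowerSeries.coeff_subst' hs,
    finsum_eq_single _ 0]
  · simp
  · intro m hm
    rw [PowerSeries.coeff_zero_eq_constantCoeff_apply, map_pow, hX, zero_pow hm, smul_zero]

variable [Algebra ℚ R]

/-- A power series is determined by its constant coefficient and its logarithmic derivative. -/
theorem powerSeries_ext_of_derivative {A B Y : PowerSeries R}
    (hA : PowerSeries.derivative R A = A * Y) (hB : PowerSeries.derivative R B = B * Y)
    (h0 : PowerSeries.constantCoeff A = PowerSeries.constantCoeff B) : A = B := by
  ext n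
  induction n using Nat.strong_induction_on with
  | _ n ih =>
    rcases n with _ | n
    · simpa using h0
    have h1 := congrArg (PowerSeries.coeff n) hA
    have h2 := congrArg (PowerSeries.coeff n) hB
    rw [PowerSeries.coeff_derivative, PowerSeries.coeff_mul] at h1 h2
    have h3 : PowerSeries.coeff (n + 1) A * ((n : R) + 1) =
        PowerSeries.coeff (n + 1) B * ((n : R) + 1) := by
      rw [h1, h2]
      refine sum_congr rfl fun p hp => ?_
      rw [ih p.1 (by have := mem_antidiagonal.1 hp; omega)]
    have hu : ((n : R) + 1) * algebraMap ℚ R ((n : ℚ) + 1)⁻¹ = 1 := by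
      have h4 : ((n : R) + 1) = algebraMap ℚ R ((n : ℚ) + 1) := by simp
      have h5 : (n : ℚ) + 1 ≠ 0 := by positivity
      rw [h4, ← map_mul, mul_inv_cancel₀ h5, map_one]
    have h6 := congrArg (· * algebraMap ℚ R ((n : ℚ) + 1)⁻¹) h3
    simpa only [mul_assoc, hu, mul_one] using h6

variable [Algebra ℂ R]

/-- Bridges the complex exponential series of the definitions and the one over `R`, to which the
chain rule over `R` applies. -/
theorem exp_subst_eq {X : PowerSeries R} (hX : PowerSeries.constantCoeff X = 0) :
    (PowerSeries.exp ℂ).subst X = (PowerSeries.exp R).subst X := by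
  have hs : PowerSeries.HasSubst X := PowerSeries.HasSubst.of_constantCoeff_zero' hX
  ext n
  rw [PowerSeries.coeff_subst' hs, PowerSeries.coeff_subst' hs]
  refine finsum_congr fun m => ?_
  rw [PowerSeries.coeff_exp, PowerSeries.coeff_exp, algebraMap_smul, algebraMap_smul]

theorem derivative_exp_subst {X : PowerSeries R} (hX : PowerSeries.constantCoeff X = 0) :
    PowerSeries.derivative R ((PowerSeries.exp ℂ).subst X) =
      (PowerSeries.exp ℂ).subst X * PowerSeries.derivative R X := by
  rw [exp_subst_eq hX,
    PowerSeries.derivative_subst (PowerSeries.HasSubst.of_constantCoeff_zero' hX),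
    PowerSeries.derivative_exp]

end Series

/-! ### Iterated directional derivatives along lists -/

section ListDerivatives

variable {ι E F : Type*} [NormedAddCommGroup E] [NormedSpace ℝ E] [NormedAddCommGroup F]
  [NormedSpace ℝ F]

/-- The iterated derivative of `f` in the directions `v i`, for `i` in a list. -/
def listDeriv (v : ι → E) (f : E → F) : List ι → E → F
  | [] => f
  | i :: l => fun x => fderiv ℝ (listDeriv v f l) x (v i)

theorem contDiff_listDeriv (v : ι → E) {f : E → F} (hf : ContDiff ℝ ∞ f) (l : List ι) :
    ContDiff ℝ ∞ (listDeriv v f l) := by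
  induction l with
  | nil => exact hf
  | cons i l ih => exact (ih.fderiv_right (m := ∞) le_rfl).clm_apply contDiff_const

/-- Swapping two neighbouring directions is the symmetry of the second derivative. As a result the
arbitrary order of `Finset.toList` is harmless, and derivatives can be indexed by blocks of a
partition. -/
theorem listDeriv_perm (v : ι → E) {f : E → F} (hf : ContDiff ℝ ∞ f) {l l' : List ι}
    (h : l.Perm l') : listDeriv v f l = listDeriv v f l' := by
  induction h with
  | nil => rfl
  | cons i _ ih => simp only [listDeriv, ih]
  | swap i j l =>
    funext x
    have hg := contDiff_listDeriv v hf l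
    have hd : DifferentiableAt ℝ (fderiv ℝ (listDeriv v f l)) x :=
      ((hg.fderiv_right (m := ∞) le_rfl).differentiable (by simp)).differentiableAt
    simp only [listDeriv]
    rw [fderiv_clm_apply hd (differentiableAt_const _),
      fderiv_clm_apply hd (differentiableAt_const _)]
    simpa using (hg.contDiffAt.isSymmSndFDerivAt
      (by simpa using (WithTop.coe_le_coe.2 le_top : ((2 : ℕ∞) : WithTop ℕ∞) ≤ ∞))) (v j) (v i)
  | trans _ _ ih₁ ih₂ => exact ih₁.trans ih₂

theorem iteratedFDeriv_eq_listDeriv (v : ι → E) {f : E → F} (hf : ContDiff ℝ ∞ f) {n : ℕ}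
    (a : Fin n → ι) (x : E) :
    iteratedFDeriv ℝ n f x (fun j => v (a j)) = listDeriv v f (List.ofFn a) x := by
  induction n generalizing x with
  | zero => simp [listDeriv]
  | succ n ih =>
    have hd : DifferentiableAt ℝ (iteratedFDeriv ℝ n f) x :=
      (hf.differentiable_iteratedFDeriv (m := n) (by exact_mod_cast WithTop.coe_lt_top n)) x
    rw [iteratedFDeriv_succ_apply_left, List.ofFn_succ, listDeriv]
    have : listDeriv v f (List.ofFn fun i : Fin n => a i.succ) =
        fun y => iteratedFDeriv ℝ n f y (fun j => v (a j.succ)) := by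
      funext y
      exact (ih (fun j => a j.succ) y).symm
    rw [this, ← fderiv_continuousMultilinear_apply_const_apply hd]
    rfl

end ListDerivatives

/-! ### Components of symmetric tensors along finite index sets -/

section Components

variable {d : ℕ}

/-- Symmetry makes the arbitrary enumeration chosen in `component` irrelevant. -/
theorem component_eq {T : Coeffs d} (hT : T.Symmetric) {E : Type} [Fintype E] (a : E → Fin d)
    {n : ℕ} (e : Fin n ≃ E) : component T a = T n (a ∘ e) := by
  obtain rfl : n = Fintype.card E := by simpa using Fintype.card_congr e
  rw [component, ← hT _ (e.trans (Fintype.equivFin E)) fun j => a ((Fintype.equivFin E).symm j)]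
  congr 1
  funext j
  simp

theorem component_comp {T : Coeffs d} (hT : T.Symmetric) {E E' : Type} [Fintype E] [Fintype E']
    (a : E' → Fin d) (e : E ≃ E') : component T (a ∘ e) = component T a := by
  rw [component_eq hT a ((Fintype.equivFin E).symm.trans e), component]
  rfl

theorem list_ofFn_perm {α ι : Type*} (s : Finset α) (a : α → ι) {n : ℕ} (e : Fin n ≃ s) :
    (List.ofFn fun j => a (e j)).Perm (s.toList.map a) := by
  rw [← Multiset.coe_eq_coe, ← Multiset.map_coe, coe_toList, ← Fin.univ_val_map]
  have h1 : (univ : Finset (Fin n)).map (e.toEmbedding.trans (Function.Embedding.subtype _)) = s := by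
    rw [← map_map, map_univ_equiv, univ_eq_attach, attach_map_val]
  conv_rhs => rw [← h1, map_val, Multiset.map_map]
  rfl

/-- The coordinate directions. -/
abbrev coordDir (d : ℕ) (i : Fin d) : EuclideanSpace ℝ (Fin d) := EuclideanSpace.single i 1

theorem partials_symmetric {G : EuclideanSpace ℝ (Fin d) → ℝ} (hG : ContDiff ℝ ∞ G)
    (x : EuclideanSpace ℝ (Fin d)) : (partials G x).Symmetric := by
  intro m σ a
  rw [partials, partials, iteratedFDeriv_eq_listDeriv (coordDir d) hG,
    iteratedFDeriv_eq_listDeriv (coordDir d) hG, listDeriv_perm _ hG (σ.ofFn_comp_perm a)]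

theorem component_partials {G : EuclideanSpace ℝ (Fin d) → ℝ} (hG : ContDiff ℝ ∞ G)
    (x : EuclideanSpace ℝ (Fin d)) {α : Type} (s : Finset α) (a : α → Fin d) :
    component (partials G x) (fun e : s => a e) = listDeriv (coordDir d) G (s.toList.map a) x := by
  rw [component, partials, iteratedFDeriv_eq_listDeriv (coordDir d) hG]
  exact congrFun (listDeriv_perm _ hG (list_ofFn_perm s a (Fintype.equivFin s).symm)) x

end Components

/-! ### Derivatives of an exponential -/

section FaaDiBruno

variable {ι E : Type*} [NormedAddCommGroup E] [NormedSpace ℝ E]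

/-- The formula of Faà di Bruno for the iterated derivatives of an exponential. -/
theorem listDeriv_cexp {α : Type*} [DecidableEq α] (v : ι → E) {G : E → ℝ} (hG : ContDiff ℝ ∞ G)
    (c : ℂ) (a : α → ι) (s : Finset α) (x : E) :
    listDeriv v (fun y => Complex.exp (c * G y)) (s.toList.map a) x =
      Complex.exp (c * G x) *
        partSum (fun T => c * ((listDeriv v G (T.toList.map a) x : ℝ) : ℂ)) s := by
  have hf : ContDiff ℝ ∞ fun y => Complex.exp (c * G y) :=
    (contDiff_const.mul (Complex.ofRealCLM.contDiff.comp hG)).cexp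
  induction s using Finset.induction_on generalizing x with
  | empty => simp [listDeriv]
  | insert z s hz ih =>
    have hins : ∀ T : Finset α, z ∉ T →
        ((insert z T).toList.map a).Perm (a z :: T.toList.map a) := fun T hT => by
      simpa using (Finset.toList_insert hT).map a
    rw [listDeriv_perm v hf (hins s hz)]
    have hfun : listDeriv v (fun y => Complex.exp (c * G y)) (s.toList.map a) = fun y =>
        Complex.exp (c * G y) *
          ∑ P ∈ setPartitions s, ∏ b ∈ P, (c * ((listDeriv v G (b.toList.map a) y : ℝ) : ℂ)) :=
      funext ih
    have hw : ∀ T : Finset α, HasFDerivAt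
        (fun y => c * ((listDeriv v G (T.toList.map a) y : ℝ) : ℂ))
        (c • Complex.ofRealCLM.comp (fderiv ℝ (listDeriv v G (T.toList.map a)) x)) x := fun T =>
      (Complex.ofRealCLM.hasFDerivAt.comp x
        ((contDiff_listDeriv v hG _).differentiable (by simp) x).hasFDerivAt).const_mul c
    have hw0 : HasFDerivAt (fun y => c * (G y : ℂ))
        (c • Complex.ofRealCLM.comp (fderiv ℝ G x)) x :=
      (Complex.ofRealCLM.hasFDerivAt.comp x
        (hG.differentiable (by simp) x).hasFDerivAt).const_mul c
    have hD := hw0.cexp.mul (HasFDerivAt.fun_sum fun P (_ : P ∈ setPartitions s) =>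
      HasFDerivAt.finsetProd (u := P) fun b _ => hw b)
    simp only [listDeriv]
    have hD' := hD.fderiv
    rw [Pi.mul_def] at hD'
    -- The derivative falling on the exponential creates the block `{z}`, the term `T = ∅`; falling
    -- on the factor of a block `T` it enlarges that block by `z`, which is the sum over marked
    -- blocks below.
    rw [hfun, hD', partSum_insert _ hz,
      ← add_sum_erase _ _ (empty_mem_powerset s)]
    have hne : s.powerset.erase ∅ = s.powerset.filter Finset.Nonempty := by
      ext T
      simp [nonempty_iff_ne_empty, and_comm]
    have hval : ∀ b : Finset α, z ∉ b →
        listDeriv v G ((insert z b).toList.map a) x =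
          fderiv ℝ (listDeriv v G (b.toList.map a)) x (v (a z)) := fun b hb => by
      rw [listDeriv_perm v hG (hins b hb)]
      rfl
    have hp := sum_setPartitions_pointed
      (fun b => c * ((listDeriv v G ((insert z b).toList.map a) x : ℝ) : ℂ))
      (fun b => c * ((listDeriv v G (b.toList.map a) x : ℝ) : ℂ)) s
    rw [hne, ← hp]
    have h1 : ∀ P ∈ setPartitions s, ∀ b ∈ P,
        c * ((listDeriv v G ((insert z b).toList.map a) x : ℝ) : ℂ) =
        c * ((fderiv ℝ (listDeriv v G (b.toList.map a)) x (v (a z)) : ℝ) : ℂ) := fun P hP b hb => by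
      rw [hval b fun h => hz ((mem_setPartitions.1 hP).1 b hb h)]
    have h2 : listDeriv v G ((insert z ∅ : Finset α).toList.map a) x =
        fderiv ℝ G x (v (a z)) := by
      rw [hval ∅ (notMem_empty z)]
      simp [listDeriv]
    rw [h2, sdiff_empty, partSum]
    simp only [add_apply, smul_apply,
      _root_.sum_apply, ContinuousLinearMap.comp_apply, Complex.ofRealCLM_apply,
      smul_eq_mul]
    rw [mul_add, add_comm]
    congr 1
    · ring
    · congr 1
      refine sum_congr rfl fun P hP => sum_congr rfl fun b hb => ?_
      rw [h1 P hP b hb, mul_comm]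

end FaaDiBruno

/-! ### Fourier inversion for Schwartz functions -/

section Fourier

open SchwartzMap FourierTransform LineDeriv MeasureTheory

variable {V : Type*} [NormedAddCommGroup V] [InnerProductSpace ℝ V] [FiniteDimensional ℝ V]
  [MeasurableSpace V] [BorelSpace V]

/-- Read from right to left, this trades the monomial in `q` for derivatives of the function of `y`.
-/
theorem fourier_iteratedLineDerivOp_apply (f : 𝓢(V, ℂ)) {n : ℕ} (m : Fin n → V) (p : V) :
    𝓕 (∂^{m} f) p =
      (2 * Real.pi * Complex.I) ^ n * (∏ j, (inner ℝ p (m j) : ℂ)) * 𝓕 f p := by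
  induction n with
  | zero => simp [iteratedLineDerivOp_fin_zero]
  | succ n ih =>
    have ht : (fun x : V => inner ℝ x (m 0)).HasTemperateGrowth :=
      ((innerSL ℝ).flip (m 0)).hasTemperateGrowth
    rw [iteratedLineDerivOp_succ_left, fourier_lineDerivOp_eq, _root_.smul_apply,
      smulLeftCLM_apply_apply ht, ih, Fin.prod_univ_succ, pow_succ]
    simp only [Fin.tail, smul_eq_mul, Complex.real_smul]
    ring

theorem integral_exp_mul_fourier (h : 𝓢(V, ℂ)) (x : V) :
    ∫ p : V, Complex.exp ((2 * Real.pi * inner ℝ p x : ℝ) * Complex.I) * 𝓕 h p = h x := by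
  have h1 : 𝓕⁻ (𝓕 h) x = h x := by rw [fourierInv_fourier_eq]
  rw [← h1, fourierInv_coe, Real.fourierInv_eq']
  rfl

theorem integrable_exp_mul_fourier (h : 𝓢(V, ℂ)) (x : V) :
    Integrable fun p : V => Complex.exp ((2 * Real.pi * inner ℝ p x : ℝ) * Complex.I) * 𝓕 h p := by
  refine (𝓕 h).integrable.bdd_mul (c := 1) ?_ ?_
  · exact (by fun_prop : Continuous fun p : V =>
      Complex.exp ((2 * Real.pi * inner ℝ p x : ℝ) * Complex.I)).aestronglyMeasurable
  · exact Filter.Eventually.of_forall fun p => (Complex.norm_exp_ofReal_mul_I _).le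

end Fourier

/-! ### Oscillatory integrals of polynomials -/

section Oscillatory

open MeasureTheory SchwartzMap FourierTransform LineDeriv

variable {d : ℕ} {S : Coeffs d} {G : EuclideanSpace ℝ (Fin d) → ℝ} {ħ : ℝ}

theorem innerIntegral_eq_eval_mul (P : MvPolynomial (Fin d) ℂ)
    (χ : EuclideanSpace ℝ (Fin d) → ℝ) (ε : ℝ) (q : EuclideanSpace ℝ (Fin d)) :
    innerIntegral S G ħ P χ ε q =
      MvPolynomial.eval (fun i => (q i : ℂ)) P * innerIntegral S G ħ 1 χ ε q := by
  rw [innerIntegral, innerIntegral, ← integral_const_mul]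
  refine integral_congr_ae (Filter.Eventually.of_forall fun y => ?_)
  simp only [map_one]
  ring

/-- Linearity holds because the definition includes integrability in `q` for each `ε`, so sum and
integral commute before the limit. -/
theorem HasOscIntegral.sum_C_mul {κ : Type*} (s : Finset κ) (c : κ → ℂ)
    (P : κ → MvPolynomial (Fin d) ℂ) (v : κ → ℂ)
    (h : ∀ k ∈ s, HasOscIntegral S G ħ (P k) (v k)) :
    HasOscIntegral S G ħ (∑ k ∈ s, MvPolynomial.C (c k) * P k) (∑ k ∈ s, c k * v k) := by
  intro χ hχ
  have hfun : ∀ ε, innerIntegral S G ħ (∑ k ∈ s, MvPolynomial.C (c k) * P k) χ ε =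
      fun q => ∑ k ∈ s, c k * innerIntegral S G ħ (P k) χ ε q := by
    intro ε
    funext q
    rw [innerIntegral_eq_eval_mul, map_sum, sum_mul]
    refine sum_congr rfl fun k _ => ?_
    rw [innerIntegral_eq_eval_mul (P k), map_mul, MvPolynomial.eval_C, mul_assoc]
  refine ⟨fun ε hε => ?_, ?_⟩
  · rw [hfun]
    exact integrable_finsetSum _ fun k hk => ((h k hk χ hχ).1 ε hε).const_mul _
  · refine (tendsto_finsetSum s fun k hk => ((h k hk χ hχ).2.const_mul (c k))).congr' ?_
    filter_upwards [self_mem_nhdsWithin] with ε hε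
    rw [hfun, integral_finsetSum _ fun k hk => ((h k hk χ hχ).1 ε hε).const_mul _, mul_sum]
    refine sum_congr rfl fun k _ => ?_
    rw [integral_const_mul]
    ring

theorem contDiff_cexp_mul (hG : ContDiff ℝ ∞ G) (c : ℂ) :
    ContDiff ℝ ∞ fun y => Complex.exp (c * G y) :=
  (contDiff_const.mul (Complex.ofRealCLM.contDiff.comp hG)).cexp

/-- The oscillatory integral of a monomial is a derivative of `exp ((i/ħ) G)`. -/
theorem hasOscIntegral_monomial (hG : ContDiff ℝ ∞ G) (hħ : 0 < ħ) {n : ℕ} (a : Fin n → Fin d) :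
    HasOscIntegral S G ħ (∏ j, MvPolynomial.X (a j))
      (((ħ : ℂ) / Complex.I) ^ n * Complex.exp (Complex.I / ħ * S.zeroth) *
        listDeriv (coordDir d) (fun y => Complex.exp (Complex.I / ħ * G y)) (List.ofFn a)
          S.phi) := by
  intro χ hχ
  set g : EuclideanSpace ℝ (Fin d) → ℂ := fun y => Complex.exp (Complex.I / ħ * G y) with hg
  have hgs : ContDiff ℝ ∞ g := contDiff_cexp_mul hG _
  set K : ℂ := ((ħ : ℂ) / Complex.I) ^ n * Complex.exp (Complex.I / ħ * S.zeroth) with hK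
  have hħ' : (ħ : ℂ) ≠ 0 := by exact_mod_cast hħ.ne'
  have hπ : (Real.pi : ℂ) ≠ 0 := by exact_mod_cast Real.pi_ne_zero
  have hr : (2 * Real.pi * ħ) ≠ 0 := by positivity
  have hfs : ∀ ε : ℝ, ContDiff ℝ ∞ fun y => (χ (ε • y) : ℂ) * g y := fun ε =>
    (Complex.ofRealCLM.contDiff.comp (hχ.smooth.comp (contDiff_const_smul ε))).mul hgs
  have hfc : ∀ ε : ℝ, 0 < ε → HasCompactSupport fun y => (χ (ε • y) : ℂ) * g y := fun ε hε =>
    HasCompactSupport.mul_right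
      ((hχ.compact.comp_smul hε.ne').comp_left (g := fun r : ℝ => (r : ℂ)) Complex.ofReal_zero)
  -- With `p = q / (2πħ)` the kernel `exp (-(i/ħ) y·q)` is the Fourier kernel `exp (-2πi y·p)`. The
  -- cut-off exponential is smooth with compact support, hence Schwartz, and the monomial in `q`
  -- turns its transform into the transform of a derivative.
  have key : ∀ ε : ℝ, (hε : 0 < ε) →
      innerIntegral S G ħ (∏ j, MvPolynomial.X (a j)) χ ε = fun q =>
        K * (Complex.exp ((2 * Real.pi * inner ℝ ((2 * Real.pi * ħ)⁻¹ • q) S.phi : ℝ) * Complex.I) *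
          𝓕 (∂^{fun j => coordDir d (a j)} ((hfc ε hε).toSchwartzMap (hfs ε)))
            ((2 * Real.pi * ħ)⁻¹ • q)) := by
    intro ε hε
    funext q
    have h1 : innerIntegral S G ħ 1 χ ε q = Complex.exp (Complex.I / ħ * S.zeroth) *
        (Complex.exp ((2 * Real.pi * inner ℝ ((2 * Real.pi * ħ)⁻¹ • q) S.phi : ℝ) * Complex.I) *
          𝓕 ((hfc ε hε).toSchwartzMap (hfs ε)) ((2 * Real.pi * ħ)⁻¹ • q)) := by
      rw [fourier_coe, Real.fourier_eq', ← mul_assoc, ← integral_const_mul, innerIntegral]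
      refine integral_congr_ae (Filter.Eventually.of_forall fun y => ?_)
      have hf : (hfc ε hε).toSchwartzMap (hfs ε) y = (χ (ε • y) : ℂ) * g y := rfl
      simp only [map_one, hf, hg, smul_eq_mul, mul_one]
      have e1 : inner ℝ ((2 * Real.pi * ħ)⁻¹ • q) S.phi =
          (2 * Real.pi * ħ)⁻¹ * ∑ i, S.phi i * q i := by
        rw [real_inner_smul_left, PiLp.inner_apply]
        simp [mul_comm]
      have e2 : inner ℝ y ((2 * Real.pi * ħ)⁻¹ • q) = (2 * Real.pi * ħ)⁻¹ * ∑ i, y i * q i := by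
        rw [real_inner_smul_right, PiLp.inner_apply]
        simp [mul_comm]
      rw [e1, e2]
      have e3 : ∀ A B C D E' : ℂ, Complex.exp A * Complex.exp B * (Complex.exp C * (D * Complex.exp E'))
          = D * Complex.exp (A + B + C + E') := by
        intro A B C D E'
        simp only [Complex.exp_add]
        ring
      rw [e3]
      congr 2
      push_cast
      field_simp
      ring
    rw [innerIntegral_eq_eval_mul, h1, fourier_iteratedLineDerivOp_apply, map_prod]
    have h2 : ∀ j, (inner ℝ ((2 * Real.pi * ħ)⁻¹ • q) (coordDir d (a j)) : ℂ) =
        (2 * Real.pi * ħ : ℂ)⁻¹ * (q (a j) : ℂ) := by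
      intro j
      have : inner ℝ ((2 * Real.pi * ħ)⁻¹ • q) (coordDir d (a j)) =
          (2 * Real.pi * ħ)⁻¹ * q (a j) := by
        rw [real_inner_smul_left, coordDir, EuclideanSpace.inner_single_right]
        simp
      rw [this]
      push_cast
      rfl
    simp only [h2, MvPolynomial.eval_X, prod_mul_distrib, prod_const, card_univ, Fintype.card_fin,
      hK]
    -- Each derivative yields `2πi` and each rescaled coordinate `1/(2πħ)`; the factor `ħ/i` in `K`
    -- undoes their product.
    have h3 : ((ħ : ℂ) / Complex.I) ^ n * ((2 * Real.pi * Complex.I) ^ n *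
        ((2 * Real.pi * ħ : ℂ)⁻¹) ^ n) = 1 := by
      rw [← mul_pow, ← mul_pow]
      have : (ħ : ℂ) / Complex.I * (2 * Real.pi * Complex.I * (2 * Real.pi * ħ : ℂ)⁻¹) = 1 := by
        field_simp
      rw [this, one_pow]
    linear_combination (-(Complex.exp (Complex.I / ħ * S.zeroth) *
        (Complex.exp ((2 * Real.pi * inner ℝ ((2 * Real.pi * ħ)⁻¹ • q) S.phi : ℝ) * Complex.I) *
          𝓕 ((hfc ε hε).toSchwartzMap (hfs ε)) ((2 * Real.pi * ħ)⁻¹ • q)) *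
          ∏ j, (q (a j) : ℂ))) * h3
  -- The Jacobian `(2πħ)^d` of the rescaling cancels the normalisation of `đq`, and Fourier
  -- inversion evaluates the derivative at `φ`.
  have hint : ∀ ε : ℝ, (hε : 0 < ε) → (((2 * Real.pi * ħ) ^ d : ℝ) : ℂ)⁻¹ *
      ∫ q, innerIntegral S G ħ (∏ j, MvPolynomial.X (a j)) χ ε q =
        K * iteratedFDeriv ℝ n (fun y => (χ (ε • y) : ℂ) * g y) S.phi
          (fun j => coordDir d (a j)) := by
    intro ε hε
    rw [key ε hε, Measure.integral_comp_smul volume (fun p => K *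
      (Complex.exp ((2 * Real.pi * inner ℝ p S.phi : ℝ) * Complex.I) *
        𝓕 (∂^{fun j => coordDir d (a j)} ((hfc ε hε).toSchwartzMap (hfs ε))) p)),
      integral_const_mul, integral_exp_mul_fourier, finrank_euclideanSpace_fin, inv_pow, inv_inv,
      abs_of_pos (by positivity), Complex.real_smul, ← mul_assoc, inv_mul_cancel₀, one_mul,
      iteratedLineDerivOp_eq_iteratedFDeriv]
    · rfl
    · exact_mod_cast pow_ne_zero d hr
  refine ⟨fun ε hε => ?_, ?_⟩
  · rw [key ε hε]
    exact ((integrable_exp_mul_fourier _ S.phi).const_mul K).comp_smul (inv_ne_zero hr)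
  -- For small `ε` the cutoff equals `1` on a neighbourhood of `φ`, so the regularised integral is
  -- already constant in `ε` and independent of `χ`. Currying gives a whole neighbourhood for each
  -- such `ε`, as the derivatives require.
  · refine tendsto_const_nhds.congr' ?_
    have hcont : Filter.Tendsto (fun z : ℝ × EuclideanSpace ℝ (Fin d) => z.1 • z.2)
        (𝓝 0 ×ˢ 𝓝 S.phi) (𝓝 0) := by
      have : Continuous fun z : ℝ × EuclideanSpace ℝ (Fin d) => z.1 • z.2 := by fun_prop
      simpa [nhds_prod_eq] using this.tendsto (0, S.phi)
    have hev := (hcont.eventually hχ.one_near).curry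
    filter_upwards [self_mem_nhdsWithin, nhdsWithin_le_nhds hev] with ε hε hε'
    rw [hint ε hε]
    have heq : (fun y => (χ (ε • y) : ℂ) * g y) =ᶠ[𝓝 S.phi] g := by
      filter_upwards [hε'] with y hy
      rw [hy, Complex.ofReal_one, one_mul]
    rw [(heq.iteratedFDeriv ℝ n).eq_of_nhds, iteratedFDeriv_eq_listDeriv (coordDir d) hgs]

end Oscillatory

/-! ### Weights of edge-labelled graphs and the exponential formula for them -/

section Weights

variable {d : ℕ} (S : Coeffs d) (G : EuclideanSpace ℝ (Fin d) → ℝ) (ħ : ℝ)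

/-- The weight of a black vertex with set `T` of edges. -/
def blackWeight (n : ℕ) (a : Fin n → Fin d) (T : Finset (Fin n)) : ℂ :=
  if 2 ≤ #T then
    Complex.I / ħ * ((#T).factorial * (component S (fun e : T => a e) : ℝ) : ℂ) else 0

/-- The weight of a white vertex with set `T` of edges. -/
def whiteWeight (n : ℕ) (a : Fin n → Fin d) (T : Finset (Fin n)) : ℂ :=
  Complex.I / ħ * (component (partials G S.phi) (fun e : T => a e) : ℝ)

/-- The total weight of all the graphs with set `s` of edges. -/
def fullWeight (n : ℕ) (a : Fin n → Fin d) (s : Finset (Fin n)) : ℂ :=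
  ((ħ : ℂ) / Complex.I) ^ #s *
    (partSum (blackWeight S ħ n a) s * partSum (whiteWeight S G ħ n a) s)

/-- The total weight of the connected graphs with set `s` of edges. -/
def connWeight (n : ℕ) (a : Fin n → Fin d) (s : Finset (Fin n)) : ℂ :=
  ((ħ : ℂ) / Complex.I) ^ #s * connSum (blackWeight S ħ n a) (whiteWeight S G ħ n a) s

variable {S G ħ}

theorem component_map {T : Coeffs d} (hT : T.Symmetric) {k n : ℕ} (e : Fin k ↪ Fin n)
    (a : Fin n → Fin d) (s : Finset (Fin k)) :
    component T (fun x : s => (a ∘ e) x) = component T (fun x : s.map e => a x) :=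
  component_comp hT (fun x : s.map e => a x) (Equiv.ofBijective
    (fun x : s => (⟨e x, mem_map_of_mem e x.2⟩ : s.map e))
    ⟨fun _ _ h => Subtype.ext (e.injective (congrArg Subtype.val h)), fun ⟨y, hy⟩ => by
      obtain ⟨x, hx, rfl⟩ := mem_map.1 hy
      exact ⟨⟨x, hx⟩, rfl⟩⟩)

theorem natural_blackWeight (hS : S.Symmetric) : Natural (blackWeight S ħ) := by
  intro k n e a s
  simp only [blackWeight, card_map, component_map hS]

theorem natural_whiteWeight (hG : ContDiff ℝ ∞ G) : Natural (whiteWeight S G ħ) := by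
  intro k n e a s
  simp only [whiteWeight, component_map (partials_symmetric hG _)]

theorem natural_fullWeight (hS : S.Symmetric) (hG : ContDiff ℝ ∞ G) :
    Natural (fullWeight S G ħ) := by
  intro k n e a s
  have h := ((natural_blackWeight (ħ := ħ) hS).partSum.mul
    (natural_whiteWeight (S := S) (ħ := ħ) hG).partSum) e a s
  simp only at h
  rw [fullWeight, fullWeight, h, card_map]

theorem natural_connWeight (hS : S.Symmetric) (hG : ContDiff ℝ ∞ G) :
    Natural (connWeight S G ħ) := by
  intro k n e a s
  have h := ((natural_blackWeight (ħ := ħ) hS).connSum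
    (natural_whiteWeight (S := S) (ħ := ħ) hG)) e a s
  simp only at h
  rw [connWeight, connWeight, h, card_map]

/-- A graph is the component of the edge `0` together with the rest, and the power of `ħ/i` is
multiplicative in the set of edges. -/
theorem fullWeight_eq_sum (n : ℕ) (a : Fin (n + 1) → Fin d) :
    fullWeight S G ħ (n + 1) a univ = ∑ T ∈ univ.powerset with 0 ∈ T,
      connWeight S G ħ (n + 1) a T * fullWeight S G ħ (n + 1) a (univ \ T) := by
  rw [fullWeight, partSum_mul_partSum _ _ (mem_univ 0), mul_sum]
  refine sum_congr rfl fun T _ => ?_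
  rw [connWeight, fullWeight, ← card_sdiff_add_card_eq_card (subset_univ T), pow_add]
  ring

theorem derivative_labelSeries_fullWeight (hS : S.Symmetric) (hG : ContDiff ℝ ∞ G) :
    PowerSeries.derivative ℂ (labelSeries (fullWeight S G ħ)) =
      labelSeries (fullWeight S G ħ) * PowerSeries.derivative ℂ (labelSeries (connWeight S G ħ)) :=
  derivative_labelSeries (natural_connWeight hS hG) (natural_fullWeight hS hG) fullWeight_eq_sum

theorem component_univ {T : Coeffs d} (hT : T.Symmetric) {n : ℕ} (a : Fin n → Fin d) :
    component T (fun x : (univ : Finset (Fin n)) => a x) = T n a :=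
  component_eq (E := (univ : Finset (Fin n))) hT (fun x => a x)
    (Equiv.subtypeUnivEquiv fun x => mem_univ x).symm

/-- The amplitudes as sums over set partitions. -/
theorem amplitude_eq (hS : S.Symmetric) (n : ℕ) :
    amplitude S ħ n = ∑ a : Fin n → Fin d,
      MvPolynomial.C ((n.factorial : ℂ)⁻¹ * partSum (blackWeight S ħ n a) univ) *
        ∏ j, MvPolynomial.X (a j) := by
  let R := MvPolynomial (Fin d) ℂ
  let M : (n : ℕ) → (Fin n → Fin d) → Finset (Fin n) → R := fun n a s =>
    ∏ j ∈ s, MvPolynomial.X (a j)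
  let V : (n : ℕ) → (Fin n → Fin d) → Finset (Fin n) → R := fun n a s =>
    MvPolynomial.C (blackWeight S ħ n a s) * M n a s
  let U : (n : ℕ) → (Fin n → Fin d) → Finset (Fin n) → R := fun n a s =>
    MvPolynomial.C (partSum (blackWeight S ħ n a) s) * M n a s
  have hM : Natural M := by
    intro k n e a s
    simp only [M, prod_map, Function.comp_apply]
  have hV : Natural V := by
    intro k n e a s
    simp only [V, hM e a s, natural_blackWeight hS e a s]
  have hU : Natural U := by
    intro k n e a s
    have := (natural_blackWeight (ħ := ħ) hS).partSum e a s
    simp only at this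
    simp only [U, hM e a s, this]
  have hrec : ∀ (n : ℕ) (a : Fin (n + 1) → Fin d),
      U (n + 1) a univ =
        ∑ T ∈ univ.powerset with 0 ∈ T, V (n + 1) a T * U (n + 1) a (univ \ T) := by
    intro n a
    simp only [U, V, M]
    rw [partSum_eq_sum_block _ (mem_univ 0), map_sum, sum_mul]
    refine sum_congr rfl fun T _ => ?_
    rw [← prod_sdiff (subset_univ T), map_mul]
    ring
  have hsmul : ∀ (n : ℕ) (z : ℂ), (n.factorial : ℚ)⁻¹ • (MvPolynomial.C z : R) =
      MvPolynomial.C ((n.factorial : ℂ)⁻¹ * z) := by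
    intro n z
    rw [Algebra.smul_def, IsScalarTower.algebraMap_apply ℚ ℂ R, MvPolynomial.algebraMap_eq,
      ← map_mul]
    simp
  -- The `m!` in `blackWeight` cancels the `1/m!` of the generating function, and its vanishing
  -- below size two removes the constant and linear terms of `S`.
  have hVs : labelSeries V = higherPart S ħ := by
    ext1 m
    rw [labelSeries, higherPart, PowerSeries.coeff_mk, PowerSeries.coeff_mk, labelSum, smul_sum]
    split_ifs with hm
    · refine sum_congr rfl fun a _ => ?_
      simp only [V, M, blackWeight, card_univ, Fintype.card_fin, if_pos hm]
      rw [← smul_mul_assoc, hsmul, component_univ hS]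
      congr 2
      have : (m.factorial : ℂ) ≠ 0 := by exact_mod_cast m.factorial_ne_zero
      field_simp
    · refine sum_eq_zero fun a _ => ?_
      simp only [V, blackWeight, card_univ, Fintype.card_fin, if_neg hm, map_zero, zero_mul,
        smul_zero]
  have h0 : PowerSeries.constantCoeff (higherPart S ħ) = 0 := by
    simp [higherPart, ← PowerSeries.coeff_zero_eq_constantCoeff_apply]
  -- `U` counts partitions and `V` single blocks, so the recursion by the block of `0` identifies
  -- the series of `U` with the exponential of that of `V`.
  have hUs : labelSeries U = (PowerSeries.exp ℂ).subst (higherPart S ħ) := by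
    refine powerSeries_ext_of_derivative (Y := PowerSeries.derivative R (higherPart S ħ))
      ?_ (derivative_exp_subst h0) ?_
    · rw [derivative_labelSeries hV hU hrec, hVs]
    · rw [constantCoeff_exp_subst h0, ← PowerSeries.coeff_zero_eq_constantCoeff_apply, labelSeries,
        PowerSeries.coeff_mk, labelSum]
      simp [U, M]
  rw [amplitude, ← hUs, labelSeries, PowerSeries.coeff_mk, labelSum, smul_sum]
  refine sum_congr rfl fun a _ => ?_
  simp only [U, M]
  rw [← smul_mul_assoc, hsmul]

/-- The terms of the formal integral as sums over labelled graphs. -/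
theorem hasOscIntegral_amplitude (hS : S.Symmetric) (hG : ContDiff ℝ ∞ G) (hħ : 0 < ħ) (n : ℕ) :
    HasOscIntegral S G ħ (amplitude S ħ n)
      (Complex.exp (Complex.I / ħ * (S.zeroth + G S.phi)) *
        PowerSeries.coeff n (labelSeries (fullWeight S G ħ))) := by
  rw [amplitude_eq hS]
  have h := HasOscIntegral.sum_C_mul (S := S) (G := G) (ħ := ħ) univ
    (fun a : Fin n → Fin d => (n.factorial : ℂ)⁻¹ * partSum (blackWeight S ħ n a) univ)
    _ _ (fun a _ => hasOscIntegral_monomial hG hħ a)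
  convert h using 1
  rw [labelSeries, PowerSeries.coeff_mk, labelSum, smul_sum, mul_sum]
  refine sum_congr rfl fun a _ => ?_
  have hperm : (List.ofFn a).Perm ((univ : Finset (Fin n)).toList.map a) :=
    list_ofFn_perm univ a (Equiv.subtypeUnivEquiv fun x => mem_univ x).symm
  rw [listDeriv_perm _ (contDiff_cexp_mul hG _) hperm, listDeriv_cexp _ hG, fullWeight]
  have hw : whiteWeight S G ħ n a = fun T => Complex.I / ħ *
      ((listDeriv (coordDir d) G (T.toList.map a) S.phi : ℝ) : ℂ) := by
    funext T
    rw [whiteWeight, component_partials hG]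
  rw [hw, card_univ, Fintype.card_fin, mul_add, Complex.exp_add, Algebra.smul_def]
  simp only [eq_ratCast]
  push_cast
  ring

/-- The exponential of a series whose terms are the sums over connected labelled graphs. -/
theorem coeff_expSeries (hS : S.Symmetric) (hG : ContDiff ℝ ∞ G) {X : PowerSeries ℂ}
    (h0 : PowerSeries.constantCoeff X = Complex.I / ħ * (S.zeroth + G S.phi))
    (hX : ∀ n, PowerSeries.coeff (n + 1) X =
      PowerSeries.coeff (n + 1) (labelSeries (connWeight S G ħ))) (n : ℕ) :
    PowerSeries.coeff n (expSeries X) = Complex.exp (Complex.I / ħ * (S.zeroth + G S.phi)) *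
      PowerSeries.coeff n (labelSeries (fullWeight S G ħ)) := by
  have hz : PowerSeries.constantCoeff (X - PowerSeries.C (PowerSeries.constantCoeff X)) = 0 := by
    simp
  -- Differentiation discards the constant coefficient of `X`, which `expSeries` exponentiates
  -- separately; agreement in positive degrees suffices.
  have hd : PowerSeries.derivative ℂ (X - PowerSeries.C (PowerSeries.constantCoeff X)) =
      PowerSeries.derivative ℂ (labelSeries (connWeight S G ħ)) := by
    ext m
    rw [PowerSeries.coeff_derivative, PowerSeries.coeff_derivative, map_sub, hX,
      PowerSeries.coeff_C, if_neg m.succ_ne_zero, sub_zero]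
  have hE : (PowerSeries.exp ℂ).subst (X - PowerSeries.C (PowerSeries.constantCoeff X)) =
      labelSeries (fullWeight S G ħ) := by
    refine powerSeries_ext_of_derivative (derivative_exp_subst hz) ?_ ?_
    · rw [hd]
      exact derivative_labelSeries_fullWeight hS hG
    · rw [constantCoeff_exp_subst hz, ← PowerSeries.coeff_zero_eq_constantCoeff_apply,
        labelSeries, PowerSeries.coeff_mk, labelSum]
      simp [fullWeight]
  rw [expSeries, hE, h0, PowerSeries.coeff_smul, smul_eq_mul]

end Weights

/-! ### Graphs with labelled vertices, automorphisms and isomorphism classes -/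

/-- A map on a finite group that is injective modulo a set `H` acting from the left. -/
theorem card_image_mul_card {G X : Type*} [Group G] [Fintype G] [DecidableEq X] (φ : G → X)
    (H : Set G) (h : ∀ p p', φ p = φ p' ↔ p * p'⁻¹ ∈ H) :
    #(univ.image φ) * Nat.card H = Fintype.card G := by
  classical
  rw [← card_univ, card_eq_sum_card_image φ univ, sum_const_nat]
  intro x hx
  obtain ⟨p', -, rfl⟩ := mem_image.1 hx
  rw [Nat.card_eq_fintype_card, ← Set.toFinset_card]
  -- The fibre of `φ` through `p'` is the translate `H p'`, so all fibres have the size of `H`.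
  refine card_bij' (fun p _ => p * p'⁻¹) (fun p _ => p * p') ?_ ?_ ?_ ?_
  · intro p hp
    rw [mem_filter] at hp
    exact Set.mem_toFinset.2 ((h p p').1 hp.2)
  · intro p hp
    rw [Set.mem_toFinset] at hp
    rw [mem_filter]
    exact ⟨mem_univ _, (h _ _).2 (by simpa using hp)⟩
  · intro p _
    simp
  · intro p _
    simp

namespace BipGraph

variable (γ : BipGraph)

theorem numEdges_eq_sum : γ.numEdges = ∑ b, ∑ w, γ.mult b w := by
  simp [numEdges, Fintype.card_sigma]

theorem mult_le_numEdges (b : Fin γ.nB) (w : Fin γ.nW) : γ.mult b w ≤ γ.numEdges := by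
  rw [numEdges_eq_sum]
  exact (single_le_sum (f := fun w => γ.mult b w) (fun _ _ => Nat.zero_le _) (mem_univ w)).trans
    (single_le_sum (f := fun b => ∑ w, γ.mult b w) (fun _ _ => Nat.zero_le _) (mem_univ b))

theorem blackDeg_eq_sum (b : Fin γ.nB) : γ.blackDeg b = ∑ w, γ.mult b w := by
  have e : γ.BlackEdge b ≃ (w : Fin γ.nW) × Fin (γ.mult b w) :=
    Equiv.sigmaSubtype b
  rw [blackDeg, Fintype.card_congr e]
  simp

variable {γ}

theorem toSimpleGraph_adj {b : Fin γ.nB} {w : Fin γ.nW} (h : 0 < γ.mult b w) :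
    γ.toSimpleGraph.Adj (Sum.inl b) (Sum.inr w) := by
  rw [toSimpleGraph, SimpleGraph.fromRel_adj]
  exact ⟨by simp, Or.inl ⟨b, w, rfl, rfl, h⟩⟩

/-- In a connected graph, a nonempty set of vertices closed under adjacency is everything. -/
theorem Connected.eq_univ (hγ : γ.Connected) {A : Fin γ.nB ⊕ Fin γ.nW → Prop}
    (hne : ∃ x, A x) (hA : ∀ b w, 0 < γ.mult b w → (A (Sum.inl b) ↔ A (Sum.inr w)))
    (x : Fin γ.nB ⊕ Fin γ.nW) : A x := by
  obtain ⟨x₀, hx₀⟩ := hne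
  obtain ⟨p⟩ := hγ.preconnected x₀ x
  induction p with
  | nil => exact hx₀
  | cons hadj p ih =>
    refine ih ?_
    rw [toSimpleGraph, SimpleGraph.fromRel_adj] at hadj
    rcases hadj.2 with ⟨b, w, rfl, rfl, h⟩ | ⟨b, w, rfl, rfl, h⟩
    · exact (hA b w h).1 hx₀
    · exact (hA b w h).2 hx₀

/-- The set of vertices incident to an edge is closed under adjacency, and it is nonempty as soon as
there is one edge. -/
theorem Connected.exists_mult_pos (hγ : γ.Connected) (hn : γ.numEdges ≠ 0) :
    (∀ b, ∃ w, 0 < γ.mult b w) ∧ ∀ w, ∃ b, 0 < γ.mult b w := by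
  have h : ∃ b w, 0 < γ.mult b w := by
    by_contra! h
    refine hn ?_
    rw [numEdges_eq_sum]
    exact sum_eq_zero fun b _ => sum_eq_zero fun w _ => Nat.le_zero.1 (h b w)
  obtain ⟨b₀, w₀, h₀⟩ := h
  have := hγ.eq_univ (A := Sum.elim (fun b => ∃ w, 0 < γ.mult b w) fun w => ∃ b, 0 < γ.mult b w)
    ⟨Sum.inl b₀, w₀, h₀⟩ fun b w h => ⟨fun _ => ⟨b, h⟩, fun _ => ⟨w, h⟩⟩
  exact ⟨fun b => this (Sum.inl b), fun w => this (Sum.inr w)⟩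

theorem Connected.le_numEdges (hγ : γ.Connected) (hn : γ.numEdges ≠ 0) :
    γ.nB ≤ γ.numEdges ∧ γ.nW ≤ γ.numEdges := by
  obtain ⟨h1, h2⟩ := hγ.exists_mult_pos hn
  rw [numEdges]
  constructor
  · refine (Fintype.card_fin γ.nB).symm.le.trans (Fintype.card_le_of_surjective (fun e : γ.Edge => e.1) fun b => ?_)
    obtain ⟨w, hw⟩ := h1 b
    exact ⟨⟨b, w, ⟨0, hw⟩⟩, rfl⟩
  · refine (Fintype.card_fin γ.nW).symm.le.trans (Fintype.card_le_of_surjective (fun e : γ.Edge => e.2.1) fun w => ?_)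
    obtain ⟨b, hb⟩ := h2 w
    exact ⟨⟨b, w, ⟨0, hb⟩⟩, rfl⟩

theorem mult_eq_zero (hn : γ.numEdges = 0) (b : Fin γ.nB) (w : Fin γ.nW) : γ.mult b w = 0 :=
  Nat.le_zero.1 (hn ▸ γ.mult_le_numEdges b w)

/-- Without edges every singleton is closed under adjacency, so there is only one vertex. -/
theorem Connected.of_numEdges_eq_zero (hγ : γ.Connected) (hn : γ.numEdges = 0) :
    γ.nB = 1 ∧ γ.nW = 0 ∨ γ.nB = 0 ∧ γ.nW = 1 := by
  have key : ∀ x y : Fin γ.nB ⊕ Fin γ.nW, y = x := fun x =>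
    hγ.eq_univ ⟨x, rfl⟩ fun b w h => by rw [mult_eq_zero hn] at h; exact absurd h (lt_irrefl 0)
  have h1 : Fintype.card (Fin γ.nB ⊕ Fin γ.nW) = 1 := by
    obtain ⟨x⟩ := hγ.nonempty
    exact Fintype.card_eq_one_iff.2 ⟨x, key x⟩
  rw [Fintype.card_sum, Fintype.card_fin, Fintype.card_fin] at h1
  omega

/-- The bound that makes the labelled graphs with a given number of edges a finite set; the extra
`1` is needed only for isolated vertices. -/
theorem Connected.le_succ_numEdges (hγ : γ.Connected) :
    γ.nB ≤ γ.numEdges + 1 ∧ γ.nW ≤ γ.numEdges + 1 := by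
  by_cases hn : γ.numEdges = 0
  · have := hγ.of_numEdges_eq_zero hn
    omega
  · have := hγ.le_numEdges hn
    omega

theorem Iso.symm {γ γ' : BipGraph} : γ.Iso γ' → γ'.Iso γ := by
  rintro ⟨σ, τ, h⟩
  refine ⟨σ.symm, τ.symm, fun b w => ?_⟩
  have := h (σ.symm b) (τ.symm w)
  simp only [Equiv.apply_symm_apply] at this
  exact this.symm

variable (γ)

/-- The graph obtained by permuting the vertices. -/
def permute (p : Equiv.Perm (Fin γ.nB) × Equiv.Perm (Fin γ.nW)) : BipGraph :=
  ⟨γ.nB, γ.nW, fun b w => γ.mult (p.1 b) (p.2 w)⟩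

variable {γ}

/-- Isomorphic graphs have the same vertex types `Fin`, so an isomorphism class is an orbit of the
permutations of the vertices. -/
theorem Iso.exists_eq_permute {γ' : BipGraph} (h : γ.Iso γ') : ∃ p, γ' = γ.permute p := by
  obtain ⟨σ, τ, h⟩ := h
  obtain ⟨k, l, μ⟩ := γ'
  have hk : γ.nB = k := by simpa using Fintype.card_congr σ
  have hl : γ.nW = l := by simpa using Fintype.card_congr τ
  subst hk hl
  refine ⟨(σ.symm, τ.symm), ?_⟩
  simp only [permute, mk.injEq, heq_eq_eq, true_and]
  funext b w
  rw [← h, Equiv.apply_symm_apply, Equiv.apply_symm_apply]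

theorem iso_permute (p : Equiv.Perm (Fin γ.nB) × Equiv.Perm (Fin γ.nW)) : γ.Iso (γ.permute p) :=
  Iso.symm ⟨p.1, p.2, fun _ _ => rfl⟩

/-- The orbit-stabilizer theorem for the vertex labellings of a graph. -/
theorem card_isomorphic_mul_card_sym [DecidableEq BipGraph] :
    #(univ.image γ.permute) * Nat.card γ.sym = γ.nB.factorial * γ.nW.factorial := by
  have h := card_image_mul_card γ.permute (γ.sym : Set _) ?_
  · simpa [Fintype.card_perm] using h
  · intro p p'
    simp only [permute, mk.injEq, heq_eq_eq, true_and, SetLike.mem_coe]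
    constructor
    · intro h b w
      have := congrFun (congrFun h (p'.1⁻¹ b)) (p'.2⁻¹ w)
      simpa using this
    · intro h
      funext b w
      have := h (p'.1 b) (p'.2 w)
      simpa using this

end BipGraph

/-- The multiplicity functions of the connected white-leaved graphs with `n` edges on `k` black and
`l` white labelled vertices. -/
def multSet (n k l : ℕ) : Set (Fin k → Fin l → ℕ) :=
  {μ | BipGraph.Connected ⟨k, l, μ⟩ ∧ BipGraph.WhiteLeaved ⟨k, l, μ⟩ ∧
    BipGraph.numEdges ⟨k, l, μ⟩ = n}

theorem finite_multSet (n k l : ℕ) : (multSet n k l).Finite := by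
  refine (Set.Finite.pi' fun _ : Fin k => Set.Finite.pi' fun _ : Fin l =>
    Set.finite_Iic n).subset fun μ hμ b w => ?_
  exact hμ.2.2 ▸ BipGraph.mult_le_numEdges ⟨k, l, μ⟩ b w

/-- The multiplicity functions of the connected white-leaved graphs with `n` edges on `k` black and
`l` white labelled vertices, as a finite set. -/
def multFinset (n k l : ℕ) : Finset (Fin k → Fin l → ℕ) := (finite_multSet n k l).toFinset

theorem mem_multFinset {n k l : ℕ} {μ : Fin k → Fin l → ℕ} :
    μ ∈ multFinset n k l ↔ BipGraph.Connected ⟨k, l, μ⟩ ∧ BipGraph.WhiteLeaved ⟨k, l, μ⟩ ∧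
      BipGraph.numEdges ⟨k, l, μ⟩ = n := by
  rw [multFinset, Set.Finite.mem_toFinset]
  rfl

/-- The labelled connected white-leaved graphs with `n` edges. -/
def labelledGraphs (n : ℕ) : Finset BipGraph :=
  ((range (n + 2)).sigma fun k => (range (n + 2)).sigma fun l => multFinset n k l).map
    ⟨fun x : (k : ℕ) × (l : ℕ) × (Fin k → Fin l → ℕ) => (⟨x.1, x.2.1, x.2.2⟩ : BipGraph), by
      rintro ⟨k, l, μ⟩ ⟨k', l', μ'⟩ h
      simp only [BipGraph.mk.injEq] at h
      obtain ⟨rfl, rfl, h⟩ := h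
      rw [eq_of_heq h]⟩

theorem mem_labelledGraphs {n : ℕ} {γ : BipGraph} :
    γ ∈ labelledGraphs n ↔ γ.Connected ∧ γ.WhiteLeaved ∧ γ.numEdges = n := by
  simp only [labelledGraphs, mem_map, mem_sigma, mem_range, mem_multFinset]
  constructor
  · rintro ⟨⟨k, l, μ⟩, ⟨-, -, h⟩, rfl⟩
    exact h
  · intro h
    have h' := h.1.le_succ_numEdges
    rw [h.2.2] at h'
    exact ⟨⟨γ.nB, γ.nW, γ.mult⟩, ⟨Nat.lt_succ_iff.2 h'.1, Nat.lt_succ_iff.2 h'.2, h⟩, rfl⟩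

theorem sum_labelledGraphs {M : Type*} [AddCommMonoid M] (n : ℕ) (F : BipGraph → M) :
    ∑ γ ∈ labelledGraphs n, F γ = ∑ k ∈ range (n + 2), ∑ l ∈ range (n + 2),
      ∑ μ ∈ multFinset n k l, F ⟨k, l, μ⟩ := by
  rw [labelledGraphs, sum_map, sum_sigma]
  refine sum_congr rfl fun k _ => ?_
  rw [sum_sigma]
  rfl

theorem BipGraph.Iso.numEdges_eq {γ γ' : BipGraph} (h : γ.Iso γ') : γ'.numEdges = γ.numEdges := by
  obtain ⟨σ, τ, h⟩ := h
  rw [numEdges_eq_sum, numEdges_eq_sum, ← σ.sum_comp]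
  refine sum_congr rfl fun b _ => ?_
  rw [← τ.sum_comp]
  exact sum_congr rfl fun w _ => h b w

theorem BipGraph.Iso.whiteLeaved {γ γ' : BipGraph} (h : γ.Iso γ') (hγ : γ.WhiteLeaved) :
    γ'.WhiteLeaved := by
  obtain ⟨σ, τ, h⟩ := h
  intro b
  have := hγ (σ.symm b)
  rw [blackDeg_eq_sum] at this ⊢
  rw [← τ.sum_comp]
  simpa [← h] using this

theorem BipGraph.Iso.connected {γ γ' : BipGraph} (h : γ.Iso γ') (hγ : γ.Connected) :
    γ'.Connected := by
  obtain ⟨σ, τ, h⟩ := h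
  let f : γ.toSimpleGraph →g γ'.toSimpleGraph :=
    { toFun := Sum.map σ τ
      map_rel' := by
        intro x y hxy
        rw [toSimpleGraph, SimpleGraph.fromRel_adj] at hxy
        rcases hxy.2 with ⟨b, w, rfl, rfl, h'⟩ | ⟨b, w, rfl, rfl, h'⟩
        · exact toSimpleGraph_adj (by rwa [h])
        · exact (toSimpleGraph_adj (by rwa [h])).symm }
  exact SimpleGraph.Connected.map f (Sum.map_surjective.2 ⟨σ.surjective, τ.surjective⟩) hγ

theorem IsoClass.rep_mem_labelledGraphs (c : IsoClass) :
    c.rep ∈ labelledGraphs c.rep.numEdges :=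
  mem_labelledGraphs.2 ⟨(Quotient.out c).2.1, (Quotient.out c).2.2, rfl⟩

theorem IsoClass.eq_of_iso {c c' : IsoClass} (h : c.rep.Iso c'.rep) : c = c' := by
  rw [← Quotient.out_eq c, ← Quotient.out_eq c']
  exact Quotient.sound h

/-- Choosing representatives embeds the classes into the finite set of labelled graphs. -/
theorem finite_isoClass (n : ℕ) : {c : IsoClass | c.rep.numEdges = n}.Finite := by
  refine Set.Finite.of_finite_image (f := IsoClass.rep)
    ((labelledGraphs n).finite_toSet.subset ?_) ?_
  · rintro _ ⟨c, rfl, rfl⟩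
    exact c.rep_mem_labelledGraphs
  · intro c _ c' _ h
    exact IsoClass.eq_of_iso (by rw [h]; exact ⟨Equiv.refl _, Equiv.refl _, fun _ _ => rfl⟩)

open Classical in
/-- A sum over isomorphism classes, weighted by the automorphism groups, as a sum over labelled
graphs. -/
theorem finsum_isoClass_eq (n : ℕ) (F : BipGraph → ℂ)
    (hF : ∀ γ γ' : BipGraph, γ.Iso γ' → F γ' = F γ) :
    ∑ᶠ c ∈ {c : IsoClass | c.rep.numEdges = n}, F c.rep / (Nat.card c.rep.sym : ℂ) =
      ∑ γ ∈ labelledGraphs n, F γ / (γ.nB.factorial * γ.nW.factorial : ℂ) := by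
  rw [finsum_mem_eq_finite_toFinset_sum _ (finite_isoClass n)]
  -- The labelled graphs decompose into the orbits of the representatives; by orbit-stabilizer each
  -- orbit has `nB! nW! / |sym|` elements.
  have hU : labelledGraphs n =
      (finite_isoClass n).toFinset.biUnion fun c => univ.image c.rep.permute := by
    ext γ
    simp only [mem_biUnion, Set.Finite.mem_toFinset, Set.mem_ofPred_eq, mem_image, mem_univ,
      true_and]
    constructor
    · intro hγ
      obtain ⟨h1, h2, h3⟩ := mem_labelledGraphs.1 hγ
      have hiso : (IsoClass.rep (Quotient.mk isoSetoid ⟨γ, h1, h2⟩)).Iso γ :=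
        Quotient.mk_out (s := isoSetoid) ⟨γ, h1, h2⟩
      obtain ⟨p, hp⟩ := hiso.exists_eq_permute
      exact ⟨_, hiso.numEdges_eq.symm.trans h3, p, hp.symm⟩
    · rintro ⟨c, rfl, p, rfl⟩
      obtain ⟨h1, h2, h3⟩ := mem_labelledGraphs.1 c.rep_mem_labelledGraphs
      have hiso := BipGraph.iso_permute p
      exact mem_labelledGraphs.2 ⟨hiso.connected h1, hiso.whiteLeaved h2, hiso.numEdges_eq⟩
  rw [hU, sum_biUnion]
  · refine sum_congr rfl fun c _ => ?_
    have hc : ∀ γ ∈ univ.image c.rep.permute,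
        F γ / (γ.nB.factorial * γ.nW.factorial : ℂ) =
          F c.rep / (c.rep.nB.factorial * c.rep.nW.factorial : ℂ) := by
      intro γ hγ
      obtain ⟨p, -, rfl⟩ := mem_image.1 hγ
      rw [hF _ _ (BipGraph.iso_permute p)]
      rfl
    rw [sum_congr rfl hc, sum_const, nsmul_eq_mul]
    have h := congrArg (Nat.cast : ℕ → ℂ) (BipGraph.card_isomorphic_mul_card_sym (γ := c.rep))
    push_cast at h
    have h0 : (Nat.card c.rep.sym : ℂ) ≠ 0 := by exact_mod_cast Nat.card_pos.ne'
    have h1 : (c.rep.nB.factorial * c.rep.nW.factorial : ℂ) ≠ 0 := by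
      exact_mod_cast (Nat.mul_pos (Nat.factorial_pos _) (Nat.factorial_pos _)).ne'
    rw [← h] at h1 ⊢
    have h2 := left_ne_zero_of_mul h1
    field_simp
  · intro c _ c' _ hcc'
    refine disjoint_left.2 fun γ h h' => hcc' ?_
    obtain ⟨p, -, rfl⟩ := mem_image.1 h
    obtain ⟨p', -, hp'⟩ := mem_image.1 h'
    refine IsoClass.eq_of_iso ?_
    have h1 := BipGraph.iso_permute p
    rw [← hp'] at h1
    have h2 := (BipGraph.iso_permute p').symm
    obtain ⟨σ, τ, h1⟩ := h1
    obtain ⟨σ', τ', h2⟩ := h2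
    exact ⟨σ.trans σ', τ.trans τ', fun b w => (h2 _ _).trans (h1 b w)⟩

/-! ### Set partitions as fibres of surjections -/

section Fibers

variable {α : Type*} [Fintype α]

theorem filter_eq_injective {k : ℕ} {f : α → Fin k} (hf : Function.Surjective f) :
    Function.Injective fun j => univ.filter (f · = j) := by
  intro i j h
  obtain ⟨x, rfl⟩ := hf i
  have : x ∈ univ.filter (f · = j) := by
    rw [← show univ.filter (f · = f x) = univ.filter (f · = j) from h]
    simp
  simpa using this

variable [DecidableEq α]

/-- The fibers of a map to a finite set of labels. -/
def fibers {k : ℕ} (f : α → Fin k) : Finset (Finset α) :=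
  univ.image fun j => univ.filter (f · = j)

theorem mem_fibers {k : ℕ} {f : α → Fin k} {b : Finset α} :
    b ∈ fibers f ↔ ∃ j, univ.filter (f · = j) = b := by
  simp [fibers]

theorem card_fibers {k : ℕ} {f : α → Fin k} (hf : Function.Surjective f) : #(fibers f) = k := by
  rw [fibers, card_image_of_injective _ (filter_eq_injective hf), card_univ, Fintype.card_fin]

theorem prod_fibers {M : Type*} [CommMonoid M] {k : ℕ} {f : α → Fin k}
    (hf : Function.Surjective f) (W : Finset α → M) :
    ∏ b ∈ fibers f, W b = ∏ j, W (univ.filter (f · = j)) := by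
  rw [fibers, prod_image fun i _ j _ h => filter_eq_injective hf h]

theorem fibers_mem_setPartitions {k : ℕ} {f : α → Fin k} (hf : Function.Surjective f) :
    fibers f ∈ setPartitions (univ : Finset α) := by
  rw [mem_setPartitions]
  refine ⟨fun b _ => subset_univ b, fun h => ?_, fun b hb c hc hbc => ?_, fun x _ => ?_⟩
  · obtain ⟨j, hj⟩ := mem_fibers.1 h
    obtain ⟨x, rfl⟩ := hf j
    have : x ∈ univ.filter (f · = f x) := by simp
    rw [hj] at this
    exact notMem_empty x this
  · obtain ⟨i, rfl⟩ := mem_fibers.1 hb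
    obtain ⟨j, rfl⟩ := mem_fibers.1 hc
    refine disjoint_left.2 fun x hx hx' => hbc ?_
    rw [mem_filter] at hx hx'
    rw [← hx.2, ← hx'.2]
  · exact ⟨_, mem_fibers.2 ⟨f x, rfl⟩, by simp⟩

theorem eq_iff_of_fibers_eq {k : ℕ} {f f' : α → Fin k} (h : fibers f = fibers f') {x y : α}
    (hxy : f x = f y) : f' x = f' y := by
  have h1 : univ.filter (f · = f y) ∈ fibers f' := h ▸ mem_fibers.2 ⟨f y, rfl⟩
  obtain ⟨j, hj⟩ := mem_fibers.1 h1
  have hx : x ∈ univ.filter (f' · = j) := by rw [hj]; simp [hxy]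
  have hy : y ∈ univ.filter (f' · = j) := by rw [hj]; simp
  rw [mem_filter] at hx hy
  rw [hx.2, hy.2]

theorem exists_fibers_eq {P : Finset (Finset α)} (hP : P ∈ setPartitions (univ : Finset α)) :
    ∃ f : α → Fin #P, Function.Surjective f ∧ fibers f = P := by
  obtain ⟨-, h2, h3, h4⟩ := mem_setPartitions.1 hP
  choose B hB hxB using fun x : α => h4 x (mem_univ x)
  have huniq : ∀ b ∈ P, ∀ x ∈ b, B x = b := fun b hb x hx => by
    by_contra hne
    exact disjoint_left.1 (h3 _ (hB x) b hb hne) (hxB x) hx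
  have hfib : ∀ b : P, univ.filter (fun x => P.equivFin ⟨B x, hB x⟩ = P.equivFin b) = b.1 := by
    intro b
    ext x
    simp only [mem_filter, mem_univ, true_and, EmbeddingLike.apply_eq_iff_eq, Subtype.ext_iff]
    exact ⟨fun h => h ▸ hxB x, fun h => huniq b.1 b.2 x h⟩
  refine ⟨fun x => P.equivFin ⟨B x, hB x⟩, fun j => ?_, ?_⟩
  · obtain ⟨b, rfl⟩ := P.equivFin.surjective j
    have hne : b.1.Nonempty := nonempty_iff_ne_empty.2 fun h => h2 (h ▸ b.2)
    obtain ⟨x, hx⟩ := hne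
    refine ⟨x, congrArg P.equivFin (Subtype.ext (huniq b.1 b.2 x hx))⟩
  · ext b
    rw [mem_fibers]
    constructor
    · rintro ⟨j, rfl⟩
      obtain ⟨b, rfl⟩ := P.equivFin.surjective j
      rw [hfib]
      exact b.2
    · intro hb
      exact ⟨P.equivFin ⟨b, hb⟩, hfib ⟨b, hb⟩⟩

theorem fibers_comp_perm {k : ℕ} (f : α → Fin k) (σ : Equiv.Perm (Fin k)) :
    fibers (σ ∘ f) = fibers f := by
  ext b
  simp only [mem_fibers, Function.comp_apply]
  constructor
  · rintro ⟨j, rfl⟩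
    refine ⟨σ.symm j, ?_⟩
    simp only [Equiv.eq_symm_apply]
  · rintro ⟨j, rfl⟩
    refine ⟨σ j, ?_⟩
    simp only [EmbeddingLike.apply_eq_iff_eq]

-- Any two surjections with the same fibres differ by a permutation of the labels, which is unique
-- because the maps are onto.
open Classical in
theorem card_filter_fibers_eq {P : Finset (Finset α)}
    (hP : P ∈ setPartitions (univ : Finset α)) {k : ℕ} (hk : #P = k) :
    #{f : α → Fin k | Function.Surjective f ∧ fibers f = P} = k.factorial := by
  subst hk
  obtain ⟨f₀, hf₀, hP₀⟩ := exists_fibers_eq hP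
  have himg : ({f : α → Fin #P | Function.Surjective f ∧ fibers f = P} : Finset (α → Fin #P)) =
      univ.image fun σ : Equiv.Perm (Fin #P) => σ ∘ f₀ := by
    ext f
    simp only [mem_filter, mem_univ, true_and, mem_image]
    constructor
    · rintro ⟨hf, hfP⟩
      have h1 : fibers f₀ = fibers f := hP₀.trans hfP.symm
      have hcomp : ∀ x, f (Function.surjInv hf₀ (f₀ x)) = f x := fun x =>
        eq_iff_of_fibers_eq h1 (Function.surjInv_eq hf₀ _)
      have hsurj : Function.Surjective fun j => f (Function.surjInv hf₀ j) := by
        intro j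
        obtain ⟨x, rfl⟩ := hf j
        exact ⟨f₀ x, hcomp x⟩
      exact ⟨Equiv.ofBijective _ (Finite.surjective_iff_bijective.1 hsurj), funext hcomp⟩
    · rintro ⟨σ, rfl⟩
      exact ⟨σ.surjective.comp hf₀, by rw [fibers_comp_perm, hP₀]⟩
  rw [himg, card_image_of_injective, card_univ, Fintype.card_perm, Fintype.card_fin]
  intro σ σ' h
  ext j
  obtain ⟨x, rfl⟩ := hf₀ j
  exact congrArg Fin.val (congrFun h x)

open Classical in
/-- A sum over set partitions as a sum over partitions with labelled blocks. -/
theorem sum_setPartitions_eq (h : Finset (Finset α) → ℂ) {N : ℕ} (hN : Fintype.card α < N) :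
    ∑ P ∈ setPartitions (univ : Finset α), h P = ∑ k ∈ range N,
      (k.factorial : ℂ)⁻¹ * ∑ f : α → Fin k with Function.Surjective f, h (fibers f) := by
  have hcard : ∀ P ∈ setPartitions (univ : Finset α), #P ∈ range N := by
    intro P hP
    obtain ⟨f, hf, -⟩ := exists_fibers_eq hP
    have := Fintype.card_le_of_surjective f hf
    rw [Fintype.card_fin] at this
    exact mem_range.2 (this.trans_lt hN)
  rw [← sum_fiberwise_of_maps_to hcard]
  refine sum_congr rfl fun k _ => ?_
  have hmaps : ∀ f ∈ (univ : Finset (α → Fin k)).filter Function.Surjective,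
      fibers f ∈ (setPartitions (univ : Finset α)).filter (#· = k) := fun f hf => by
    rw [mem_filter] at hf
    exact mem_filter.2 ⟨fibers_mem_setPartitions hf.2, card_fibers hf.2⟩
  rw [← sum_fiberwise_of_maps_to hmaps, mul_sum]
  refine sum_congr rfl fun P hP => ?_
  obtain ⟨hP, hk⟩ := mem_filter.1 hP
  have h1 : ∀ f ∈ ((univ : Finset (α → Fin k)).filter Function.Surjective).filter
      (fibers · = P), h (fibers f) = h P := fun f hf => by rw [(mem_filter.1 hf).2]
  have h0 : (k.factorial : ℂ) ≠ 0 := by exact_mod_cast k.factorial_ne_zero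
  rw [sum_congr rfl h1, sum_const, filter_filter, card_filter_fibers_eq hP hk, nsmul_eq_mul,
    inv_mul_cancel_left₀ h0]

/-- The number of maps with prescribed sizes of the fibers. -/
theorem card_filter_card_fiber_mul {X : Type*} [Fintype X] [DecidableEq X] (m : X → ℕ)
    (hm : ∑ x, m x = Fintype.card α) :
    #{h : α → X | ∀ x, #{a | h a = x} = m x} * ∏ x, (m x).factorial =
      (Fintype.card α).factorial := by
  -- A model map `h₀` with the prescribed fibre sizes. Every other such map is `h₀ ∘ σ` for a
  -- permutation `σ` of `α`, and the stabilizer of `h₀` has order `∏ (m x)!`.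
  have e : α ≃ (x : X) × Fin (m x) := Fintype.equivOfCardEq (by simp [hm])
  let h₀ : α → X := fun a => (e a).1
  have hc : ∀ x, Fintype.card {a // h₀ a = x} = m x := fun x => by
    rw [Fintype.card_congr ((e.subtypeEquiv fun a => Iff.rfl).trans (Equiv.sigmaSubtype x))]
    simp
  have h1 := card_image_mul_card (G := Equiv.Perm α) (fun σ => h₀ ∘ σ) {τ | h₀ ∘ τ = h₀} ?_
  · rw [Fintype.card_perm] at h1
    rw [← h1]
    congr 1
    · congr 1
      ext h
      simp only [mem_filter, mem_univ, true_and, mem_image]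
      constructor
      · intro hh
        have hfib : ∀ x, Nonempty ({a // h a = x} ≃ {a // h₀ a = x}) := fun x =>
          ⟨Fintype.equivOfCardEq (by rw [hc, ← hh x, Fintype.card_subtype])⟩
        refine ⟨(Equiv.sigmaFiberEquiv h).symm.trans
          ((Equiv.sigmaCongrRight fun x => (hfib x).some).trans (Equiv.sigmaFiberEquiv h₀)), ?_⟩
        funext a
        exact ((hfib (h a)).some ⟨a, rfl⟩).2
      · rintro ⟨σ, rfl⟩ x
        rw [← hc x, Fintype.card_subtype]
        refine card_equiv σ fun a => ?_
        simp
    · have := DomMulAct.stabilizer_card h₀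
      simp only [hc] at this
      rw [← this, ← Nat.card_eq_fintype_card]
      rfl
  · intro σ σ'
    simp only [Set.mem_ofPred_eq]
    constructor
    · intro h
      funext a
      have := congrFun h (σ'⁻¹ a)
      simpa using this
    · intro h
      funext a
      have := congrFun h (σ' a)
      simpa using this

end Fibers

/-! ### Graphs with labelled edges as pairs of maps -/

section EdgeLabels

variable {n k l : ℕ} (f : Fin n → Fin k) (g : Fin n → Fin l)

/-- The graph with edges `Fin n` in which the edge `x` joins `f x` and `g x`. -/
abbrev mapsGraph : BipGraph := ⟨k, l, fun b w => #{x | f x = b ∧ g x = w}⟩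

/-- The identification of the edges of `mapsGraph f g` with their labels. -/
def edgeLabel (e : (mapsGraph f g).Edge) : Fin n :=
  ((univ.filter fun x => f x = e.1 ∧ g x = e.2.1).equivFin.symm e.2.2).1

theorem edgeLabel_spec (e : (mapsGraph f g).Edge) :
    f (edgeLabel f g e) = e.1 ∧ g (edgeLabel f g e) = e.2.1 := by
  have := ((univ.filter fun x => f x = e.1 ∧ g x = e.2.1).equivFin.symm e.2.2).2
  rw [mem_filter] at this
  exact this.2

theorem edgeLabel_bijective : Function.Bijective (edgeLabel f g) := by
  constructor
  · rintro ⟨b, w, i⟩ ⟨b', w', i'⟩ h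
    have h1 := edgeLabel_spec f g ⟨b, w, i⟩
    have h2 := edgeLabel_spec f g ⟨b', w', i'⟩
    rw [← h] at h2
    obtain rfl : b = b' := h1.1.symm.trans h2.1
    obtain rfl : w = w' := h1.2.symm.trans h2.2
    have : i = i' := (Equiv.injective _) (Subtype.ext h)
    rw [this]
  · intro x
    refine ⟨⟨f x, g x, (univ.filter fun y => f y = f x ∧ g y = g x).equivFin ⟨x, by simp⟩⟩, ?_⟩
    simp [edgeLabel]

/-- The edges of `mapsGraph f g` are labelled by `Fin n`. -/
def edgeEquiv : (mapsGraph f g).Edge ≃ Fin n := Equiv.ofBijective _ (edgeLabel_bijective f g)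

theorem numEdges_mapsGraph : (mapsGraph f g).numEdges = n := by
  rw [BipGraph.numEdges, Fintype.card_congr (edgeEquiv f g), Fintype.card_fin]

/-- The edges at a black vertex of `mapsGraph f g`. -/
def blackEdgeEquiv (b : Fin k) :
    (mapsGraph f g).BlackEdge b ≃ (univ.filter (f · = b) : Finset (Fin n)) :=
  (edgeEquiv f g).subtypeEquiv fun e => by
    have : f (edgeEquiv f g e) = e.1 := (edgeLabel_spec f g e).1
    simp [this]

/-- The edges at a white vertex of `mapsGraph f g`. -/
def whiteEdgeEquiv (w : Fin l) :
    (mapsGraph f g).WhiteEdge w ≃ (univ.filter (g · = w) : Finset (Fin n)) :=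
  (edgeEquiv f g).subtypeEquiv fun e => by
    have : g (edgeEquiv f g e) = e.2.1 := (edgeLabel_spec f g e).2
    simp [this]

theorem blackDeg_mapsGraph (b : Fin k) :
    (mapsGraph f g).blackDeg b = #{x | f x = b} := by
  rw [BipGraph.blackDeg, Fintype.card_congr (blackEdgeEquiv f g b), Fintype.card_coe]

theorem mult_mapsGraph_pos {b : Fin k} {w : Fin l} :
    0 < (mapsGraph f g).mult b w ↔ ∃ x, f x = b ∧ g x = w := by
  change 0 < #{x | f x = b ∧ g x = w} ↔ _
  rw [card_pos]
  simp [Finset.Nonempty]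

variable {f g}

theorem saturated_fibers_iff {T : Finset (Fin n)} :
    Saturated (fibers f) T ↔ ∀ x y, f x = f y → x ∈ T → y ∈ T := by
  constructor
  · intro h x y hxy hx
    have hb := h (univ.filter (f · = f y)) (mem_fibers.2 ⟨f y, rfl⟩)
    exact hb.resolve_right (fun hd => disjoint_left.1 hd (show x ∈ _ by simp [hxy]) hx) (by simp)
  · intro h b hb
    obtain ⟨j, rfl⟩ := mem_fibers.1 hb
    by_cases hd : Disjoint (univ.filter (f · = j)) T
    · exact Or.inr hd
    left
    obtain ⟨x, hx, hxT⟩ := not_disjoint_iff.1 hd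
    intro y hy
    rw [mem_filter] at hx hy
    exact h x y (hx.2.trans hy.2.symm) hxT

/-- Connectedness of a graph in terms of the partitions of its edges. -/
theorem connected_mapsGraph_iff (hn : n ≠ 0) :
    (mapsGraph f g).Connected ↔ Function.Surjective f ∧ Function.Surjective g ∧
      JointlyConnected univ (fibers f) (fibers g) := by
  constructor
  · intro h
    obtain ⟨h1, h2⟩ := h.exists_mult_pos (by rwa [numEdges_mapsGraph])
    refine ⟨fun b => ?_, fun w => ?_, fun T _ hT hfT hgT => ?_⟩
    · obtain ⟨w, hw⟩ := h1 b
      obtain ⟨x, hx, -⟩ := (mult_mapsGraph_pos f g).1 hw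
      exact ⟨x, hx⟩
    · obtain ⟨b, hb⟩ := h2 w
      obtain ⟨x, -, hx⟩ := (mult_mapsGraph_pos f g).1 hb
      exact ⟨x, hx⟩
    · rw [saturated_fibers_iff] at hfT hgT
      obtain ⟨x₀, hx₀⟩ := hT
      -- The endpoints of the edges in `T` form a set closed under adjacency, because `T` is
      -- saturated for both endpoint maps.
      have key := h.eq_univ
        (A := Sum.elim (fun b => ∃ x ∈ T, f x = b) fun w => ∃ x ∈ T, g x = w)
        ⟨Sum.inl (f x₀), x₀, hx₀, rfl⟩ (by
          intro b w hbw
          obtain ⟨y, rfl, rfl⟩ := (mult_mapsGraph_pos f g).1 hbw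
          constructor
          · rintro ⟨x, hx, hxy⟩
            exact ⟨y, hfT x y hxy hx, rfl⟩
          · rintro ⟨x, hx, hxy⟩
            exact ⟨y, hgT x y hxy hx, rfl⟩)
      refine eq_univ_iff_forall.2 fun y => ?_
      obtain ⟨x, hx, hxy⟩ := key (Sum.inl (f y))
      exact hfT x y hxy hx
  · rintro ⟨hf, hg, hc⟩
    classical
    let Γ := (mapsGraph f g).toSimpleGraph
    let x₀ : Fin n := ⟨0, Nat.pos_of_ne_zero hn⟩
    have hadj : ∀ x, Γ.Reachable (Sum.inl (f x)) (Sum.inr (g x)) := fun x =>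
      (BipGraph.toSimpleGraph_adj ((mult_mapsGraph_pos f g).2 ⟨x, rfl, rfl⟩)).reachable
    -- The edges reachable from `x₀` are saturated on both sides: edges sharing a black or a white
    -- endpoint are reachable together.
    have hT := hc (univ.filter fun x => Γ.Reachable (Sum.inl (f x₀)) (Sum.inl (f x)))
      (subset_univ _) ⟨x₀, by simp⟩
      (saturated_fibers_iff.2 fun x y hxy hx => by
        rw [mem_filter] at hx ⊢
        exact ⟨mem_univ _, hxy ▸ hx.2⟩)
      (saturated_fibers_iff.2 fun x y hxy hx => by
        rw [mem_filter] at hx ⊢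
        have h1 := hadj x
        rw [hxy] at h1
        exact ⟨mem_univ _, hx.2.trans (h1.trans (hadj y).symm)⟩)
    have hreach : ∀ x, Γ.Reachable (Sum.inl (f x₀)) (Sum.inl (f x)) := fun x => by
      have : x ∈ (univ : Finset (Fin n)) := mem_univ x
      rw [← hT] at this
      exact (mem_filter.1 this).2
    have hall : ∀ v, Γ.Reachable (Sum.inl (f x₀)) v := by
      rintro (b | w)
      · obtain ⟨x, rfl⟩ := hf b
        exact hreach x
      · obtain ⟨x, rfl⟩ := hg w
        exact (hreach x).trans (hadj x)
    have : Nonempty (Fin (mapsGraph f g).nB ⊕ Fin (mapsGraph f g).nW) := ⟨Sum.inl (f x₀)⟩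
    exact ⟨fun u v => (hall u).symm.trans (hall v)⟩

open Classical in
/-- The number of labellings of the edges of a graph. -/
theorem card_mapsGraph_eq (μ : Fin k → Fin l → ℕ) (hμ : BipGraph.numEdges ⟨k, l, μ⟩ = n) :
    #{p : (Fin n → Fin k) × (Fin n → Fin l) | (mapsGraph p.1 p.2).mult = μ} *
      ∏ b, ∏ w, (μ b w).factorial = n.factorial := by
  -- A pair of endpoint maps is one map to `Fin k × Fin l`, and `μ` prescribes the sizes of its
  -- fibres.
  have h := card_filter_card_fiber_mul (α := Fin n) (fun x : Fin k × Fin l => μ x.1 x.2)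
    (by rw [Fintype.card_fin, ← hμ, BipGraph.numEdges_eq_sum, ← univ_product_univ, sum_product])
  rw [Fintype.card_fin, ← univ_product_univ, prod_product] at h
  rw [← h]
  congr 1
  refine card_equiv (Equiv.arrowProdEquivProdArrow (Fin n) (fun _ => Fin k) (fun _ => Fin l)).symm fun p => ?_
  simp only [mem_filter, mem_univ, true_and, Prod.forall, Prod.ext_iff]
  exact ⟨fun h b w => congrFun (congrFun (show (mapsGraph p.1 p.2).mult = μ from h) b) w, fun h => funext fun b => funext fun w => h b w⟩

end EdgeLabels

/-- Group the white vertices by the number of shared edges. Those sharing none contribute `0! = 1`,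
which is why the product in `blackFactor` may start at `1`. -/
theorem blackFactor_eq (γ : BipGraph) (b : Fin γ.nB) :
    blackFactor γ b = (γ.blackDeg b).factorial / ∏ w, ((γ.mult b w).factorial : ℝ) := by
  have hmaps : ∀ w ∈ (univ : Finset (Fin γ.nW)), γ.mult b w ∈ range (γ.blackDeg b + 1) :=
    fun w _ => by
      rw [mem_range, Nat.lt_succ_iff, BipGraph.blackDeg_eq_sum]
      exact single_le_sum (f := fun w => γ.mult b w) (fun _ _ => Nat.zero_le _) (mem_univ w)
  have h1 : ∀ i ∈ range (γ.blackDeg b + 1),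
      ∏ w ∈ univ.filter (fun w => γ.mult b w = i), ((γ.mult b w).factorial : ℝ) =
        (i.factorial : ℝ) ^ γ.sharing b i := by
    intro i _
    rw [prod_congr rfl fun w hw => by rw [(mem_filter.1 hw).2], prod_const, BipGraph.sharing]
  rw [blackFactor, ← prod_fiberwise_of_maps_to hmaps, prod_congr rfl h1, prod_range_succ',
    Nat.factorial_zero, Nat.cast_one, one_pow, mul_one]
  congr 1
  rw [range_eq_Ico, prod_Ico_add' (fun i => (i.factorial : ℝ) ^ γ.sharing b i) 0 _ 1]
  rfl

/-! ### From edge-labelled sums to sums over isomorphism classes -/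

section Contraction

variable {d : ℕ} {S : Coeffs d} {G : EuclideanSpace ℝ (Fin d) → ℝ}

/-- The contraction in terms of labelled edges. -/
theorem contraction_mapsGraph (hS : S.Symmetric) (hG : ContDiff ℝ ∞ G) {n k l : ℕ}
    (f : Fin n → Fin k) (g : Fin n → Fin l) :
    contraction S G (mapsGraph f g) = ∑ a : Fin n → Fin d,
      (∏ b, blackFactor (mapsGraph f g) b *
        component S fun x : (univ.filter (f · = b) : Finset (Fin n)) => a x) *
      ∏ w, component (partials G S.phi) fun x : (univ.filter (g · = w) : Finset (Fin n)) => a x := by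
  rw [contraction]
  symm
  refine Fintype.sum_equiv ((edgeEquiv f g).symm.arrowCongr (Equiv.refl _)) _ _ fun a => ?_
  have h1 : ∀ b, (component S fun x : (univ.filter (f · = b) : Finset (Fin n)) => a x) =
      component S fun e : (mapsGraph f g).BlackEdge b =>
        ((edgeEquiv f g).symm.arrowCongr (Equiv.refl _)) a e.1 := fun b =>
    (component_comp hS (fun x : (univ.filter (f · = b) : Finset (Fin n)) => a x)
      (blackEdgeEquiv f g b)).symm
  have h2 : ∀ w, (component (partials G S.phi)
        fun x : (univ.filter (g · = w) : Finset (Fin n)) => a x) =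
      component (partials G S.phi) fun e : (mapsGraph f g).WhiteEdge w =>
        ((edgeEquiv f g).symm.arrowCongr (Equiv.refl _)) a e.1 := fun w =>
    (component_comp (partials_symmetric hG _)
      (fun x : (univ.filter (g · = w) : Finset (Fin n)) => a x) (whiteEdgeEquiv f g w)).symm
  simp only [h1, h2]

/-- The contraction in terms of labelled edges, with the symmetry factors of the multiple edges
cleared. -/
theorem prod_factorial_mul_contraction_mapsGraph (hS : S.Symmetric) (hG : ContDiff ℝ ∞ G)
    {n k l : ℕ} (f : Fin n → Fin k) (g : Fin n → Fin l) :
    (∏ b, ∏ w, ((mapsGraph f g).mult b w).factorial : ℝ) * contraction S G (mapsGraph f g) =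
      ∑ a : Fin n → Fin d,
        (∏ b, ((#{x | f x = b}).factorial *
          component S fun x : (univ.filter (f · = b) : Finset (Fin n)) => a x)) *
        ∏ w, component (partials G S.phi)
          fun x : (univ.filter (g · = w) : Finset (Fin n)) => a x := by
  rw [contraction_mapsGraph hS hG, mul_sum]
  refine sum_congr rfl fun a _ => ?_
  rw [← mul_assoc, ← prod_mul_distrib]
  congr 1
  refine prod_congr rfl fun b _ => ?_
  rw [blackFactor_eq, blackDeg_mapsGraph, ← mul_assoc, mul_div_cancel₀]
  exact prod_ne_zero_iff.2 fun w _ => by exact_mod_cast Nat.factorial_ne_zero _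

/-- Enumerating the edges of a graph reduces statements on arbitrary graphs to edge-labelled ones.
-/
theorem exists_mapsGraph (γ : BipGraph) :
    ∃ (n k l : ℕ) (f : Fin n → Fin k) (g : Fin n → Fin l), mapsGraph f g = γ := by
  have e : Fin γ.numEdges ≃ γ.Edge := (Fintype.equivFin γ.Edge).symm
  refine ⟨_, _, _, fun x => (e x).1, fun x => (e x).2.1, ?_⟩
  obtain ⟨k, l, μ⟩ := γ
  simp only [mapsGraph, BipGraph.mk.injEq, heq_eq_eq, true_and]
  funext b w
  have h1 : #{x | (e x).1 = b ∧ (e x).2.1 = w} =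
      Fintype.card {y : BipGraph.Edge ⟨k, l, μ⟩ // y.1 = b ∧ y.2.1 = w} := by
    rw [← Fintype.card_coe]
    exact Fintype.card_congr (e.subtypeEquiv fun x => by simp)
  rw [h1]
  let i : Fin (μ b w) → {y : BipGraph.Edge ⟨k, l, μ⟩ // y.1 = b ∧ y.2.1 = w} :=
    fun j => ⟨⟨b, w, j⟩, rfl, rfl⟩
  have hi : Function.Bijective i := by
    constructor
    · intro j j' h
      simpa [i] using h
    · rintro ⟨⟨b', w', j⟩, rfl, rfl⟩
      exact ⟨j, rfl⟩
  rw [← Fintype.card_of_bijective hi, Fintype.card_fin]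

/-- Permuting the vertices keeps the labelled edges and changes only the endpoint maps to `σ⁻¹ ∘ f`
and `τ⁻¹ ∘ g`. Once the multiplicity factorials are cleared, this merely reindexes products over
vertices. -/
theorem contraction_iso (hS : S.Symmetric) (hG : ContDiff ℝ ∞ G) {γ γ' : BipGraph}
    (h : γ.Iso γ') : contraction S G γ' = contraction S G γ := by
  obtain ⟨n, k, l, f, g, rfl⟩ := exists_mapsGraph γ
  obtain ⟨⟨σ, τ⟩, rfl⟩ := h.exists_eq_permute
  have hp : (mapsGraph f g).permute (σ, τ) = mapsGraph (σ.symm ∘ f) (τ.symm ∘ g) := by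
    simp only [BipGraph.permute, mapsGraph, Function.comp_apply, Equiv.symm_apply_eq]
  rw [hp]
  have h1 := prod_factorial_mul_contraction_mapsGraph hS hG f g
  have h2 := prod_factorial_mul_contraction_mapsGraph hS hG (σ.symm ∘ f) (τ.symm ∘ g)
  have h3 : (∏ b, ∏ w, (((mapsGraph (σ.symm ∘ f) (τ.symm ∘ g)).mult b w).factorial : ℝ)) =
      ∏ b, ∏ w, (((mapsGraph f g).mult b w).factorial : ℝ) :=
    Fintype.prod_equiv σ _ _ fun b => Fintype.prod_equiv τ _ _ fun w => by
      simp only [mapsGraph, Function.comp_apply, Equiv.symm_apply_eq]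
  have h4 : (∏ b, ∏ w, ((mapsGraph f g).mult b w).factorial : ℝ) ≠ 0 :=
    prod_ne_zero_iff.2 fun b _ => prod_ne_zero_iff.2 fun w _ => by
      exact_mod_cast Nat.factorial_ne_zero _
  refine mul_left_cancel₀ h4 ?_
  rw [h1, ← h3, h2]
  refine sum_congr rfl fun a _ => ?_
  have h5 : ∀ (T : Coeffs d) (s t : Finset (Fin n)), s = t →
      (component T fun x : s => a x) = component T fun x : t => a x := by
    rintro T s _ rfl
    rfl
  have h6 : ∀ b : Fin k, univ.filter (fun x => (σ.symm ∘ f) x = b) =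
      univ.filter fun x => f x = σ b := fun b =>
    filter_congr fun x _ => Equiv.symm_apply_eq σ
  have h7 : ∀ w : Fin l, univ.filter (fun x => (τ.symm ∘ g) x = w) =
      univ.filter fun x => g x = τ w := fun w =>
    filter_congr fun x _ => Equiv.symm_apply_eq τ
  congr 1
  · exact Fintype.prod_equiv σ _ _ fun b => by rw [h5 S _ _ (h6 b), h6 b]
  · exact Fintype.prod_equiv τ _ _ fun w => h5 _ _ _ (h7 w)

variable (S G) in
/-- The contribution of a graph to the exponent. -/
def graphTerm (ħ : ℝ) (γ : BipGraph) : ℂ :=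
  Complex.I / ħ * (((ħ : ℂ) / Complex.I) ^ γ.loopNumber * (contraction S G γ : ℂ))

theorem graphTerm_iso (hS : S.Symmetric) (hG : ContDiff ℝ ∞ G) (ħ : ℝ) {γ γ' : BipGraph}
    (h : γ.Iso γ') : graphTerm S G ħ γ' = graphTerm S G ħ γ := by
  rw [graphTerm, graphTerm, contraction_iso hS hG h, BipGraph.loopNumber, BipGraph.loopNumber,
    h.numEdges_eq]
  obtain ⟨σ, τ, -⟩ := h
  rw [show γ.nB = γ'.nB by simpa using Fintype.card_congr σ,
    show γ.nW = γ'.nW by simpa using Fintype.card_congr τ]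

open Classical in
/-- The sum over the indices of the weights of a graph with labelled edges. -/
theorem sum_prod_weights (hS : S.Symmetric) (hG : ContDiff ℝ ∞ G) {ħ : ℝ} (hħ : 0 < ħ) {n k l : ℕ}
    {f : Fin n → Fin k} {g : Fin n → Fin l} (hf : Function.Surjective f)
    (hg : Function.Surjective g) :
    ∑ a : Fin n → Fin d, ((ħ : ℂ) / Complex.I) ^ n *
      ((∏ b ∈ fibers f, blackWeight S ħ n a b) * ∏ b ∈ fibers g, whiteWeight S G ħ n a b) =
    if (mapsGraph f g).WhiteLeaved then graphTerm S G ħ (mapsGraph f g) *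
      ((∏ b, ∏ w, ((mapsGraph f g).mult b w).factorial : ℕ) : ℂ) else 0 := by
  simp only [prod_fibers hf, prod_fibers hg]
  have hħ' : (ħ : ℂ) ≠ 0 := by exact_mod_cast hħ.ne'
  split_ifs with hw
  -- Surjectivity excludes black vertices of degree `0`, white-leavedness those of degree `1`; hence
  -- no black weight takes its zero branch.
  · have hdeg : ∀ b, 2 ≤ #{x | f x = b} := by
      intro b
      have h1 := hw b
      rw [blackDeg_mapsGraph] at h1
      obtain ⟨x, hx⟩ := hf b
      have h2 : 0 < #{x | f x = b} := card_pos.2 ⟨x, by simp [hx]⟩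
      omega
    have h1 := congrArg (fun r : ℝ => (r : ℂ))
      (prod_factorial_mul_contraction_mapsGraph hS hG f g)
    push_cast at h1
    -- There are `n` factors `ħ/i` from edges and `k + l` factors `i/ħ` from vertices; setting one
    -- `i/ħ` aside leaves the exponent `n - (k + l) + 1`.
    have hpow : ((ħ : ℂ) / Complex.I) ^ n * ((Complex.I / ħ) ^ k * (Complex.I / ħ) ^ l) =
        Complex.I / ħ * ((ħ : ℂ) / Complex.I) ^ (mapsGraph f g).loopNumber := by
      have hz : (ħ : ℂ) / Complex.I ≠ 0 := div_ne_zero hħ' Complex.I_ne_zero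
      have hi : Complex.I / ħ = ((ħ : ℂ) / Complex.I)⁻¹ := (inv_div _ _).symm
      rw [BipGraph.loopNumber, numEdges_mapsGraph, zpow_add₀ hz, zpow_sub₀ hz, zpow_add₀ hz, hi,
        zpow_natCast, zpow_natCast, zpow_natCast, zpow_one,
        inv_pow, inv_pow]
      generalize (ħ : ℂ) / Complex.I = z at hz
      field_simp
    rw [graphTerm, ← mul_assoc, ← hpow]
    push_cast
    rw [mul_assoc, mul_comm (contraction S G (mapsGraph f g) : ℂ), h1, mul_sum]
    refine sum_congr rfl fun a _ => ?_
    simp only [blackWeight, if_pos (hdeg _), whiteWeight, prod_mul_distrib, prod_const, card_univ,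
      Fintype.card_fin]
    ring
  -- A black vertex of degree one has weight zero: the linear part of `S` sits in `φ`, so such
  -- graphs drop out.
  · rw [BipGraph.WhiteLeaved] at hw
    push Not at hw
    obtain ⟨b, hb⟩ := hw
    rw [blackDeg_mapsGraph] at hb
    refine sum_eq_zero fun a _ => ?_
    rw [prod_eq_zero (mem_univ b), zero_mul, mul_zero]
    rw [blackWeight, if_neg (by omega)]

open Classical in
/-- The sum over the connected graphs with labelled edges and vertices, by the multiplicities. -/
theorem sum_maps_eq_sum_mult (hS : S.Symmetric) (hG : ContDiff ℝ ∞ G) {ħ : ℝ} (hħ : 0 < ħ)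
    {n : ℕ} (hn : n ≠ 0) (k l : ℕ) :
    ∑ f : Fin n → Fin k with Function.Surjective f,
      ∑ g : Fin n → Fin l with Function.Surjective g,
        (if JointlyConnected univ (fibers f) (fibers g) then
          ∑ a : Fin n → Fin d, ((ħ : ℂ) / Complex.I) ^ n *
            ((∏ b ∈ fibers f, blackWeight S ħ n a b) * ∏ b ∈ fibers g, whiteWeight S G ħ n a b)
          else 0) =
      n.factorial * ∑ μ ∈ multFinset n k l, graphTerm S G ħ ⟨k, l, μ⟩ := by
  have h1 : ∀ (f : Fin n → Fin k) (g : Fin n → Fin l),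
      (if Function.Surjective f then if Function.Surjective g then
        (if JointlyConnected univ (fibers f) (fibers g) then
          ∑ a : Fin n → Fin d, ((ħ : ℂ) / Complex.I) ^ n *
            ((∏ b ∈ fibers f, blackWeight S ħ n a b) * ∏ b ∈ fibers g, whiteWeight S G ħ n a b)
          else 0) else 0 else 0) =
      if (mapsGraph f g).mult ∈ multFinset n k l then graphTerm S G ħ (mapsGraph f g) *
        ((∏ b, ∏ w, ((mapsGraph f g).mult b w).factorial : ℕ) : ℂ) else 0 := by
    intro f g
    have hmem : (mapsGraph f g).mult ∈ multFinset n k l ↔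
        (mapsGraph f g).Connected ∧ (mapsGraph f g).WhiteLeaved := by
      rw [mem_multFinset]
      exact ⟨fun h => ⟨h.1, h.2.1⟩, fun h => ⟨h.1, h.2, numEdges_mapsGraph f g⟩⟩
    rw [← ite_and, ← ite_and]
    by_cases hc : (mapsGraph f g).Connected
    · have hc' := (connected_mapsGraph_iff hn).1 hc
      rw [if_pos ⟨⟨hc'.1, hc'.2.1⟩, hc'.2.2⟩, sum_prod_weights hS hG hħ hc'.1 hc'.2.1]
      exact if_congr (by rw [hmem]; exact (and_iff_right hc).symm) rfl rfl
    · rw [if_neg fun h => hc ((connected_mapsGraph_iff hn).2 ⟨h.1.1, h.1.2, h.2⟩),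
        if_neg fun h => hc (hmem.1 h).1]
  simp only [sum_filter]
  have h2 : ∀ f : Fin n → Fin k, (if Function.Surjective f then
      ∑ g : Fin n → Fin l, (if Function.Surjective g then
        (if JointlyConnected univ (fibers f) (fibers g) then
          ∑ a : Fin n → Fin d, ((ħ : ℂ) / Complex.I) ^ n *
            ((∏ b ∈ fibers f, blackWeight S ħ n a b) * ∏ b ∈ fibers g, whiteWeight S G ħ n a b)
          else 0) else 0) else 0) =
      ∑ g : Fin n → Fin l, if (mapsGraph f g).mult ∈ multFinset n k l then
        graphTerm S G ħ (mapsGraph f g) *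
          ((∏ b, ∏ w, ((mapsGraph f g).mult b w).factorial : ℕ) : ℂ) else 0 := by
    intro f
    simp only [← h1]
    split_ifs with h
    · rfl
    · simp
  -- Group the pairs of maps by their multiplicity matrix `μ`; the size of each group times `∏
  -- μ(b,w)!` is `n!`.
  rw [sum_congr rfl fun f _ => h2 f, ← sum_product', univ_product_univ, ← sum_filter,
    ← sum_fiberwise_of_maps_to (t := multFinset n k l)
      (g := fun p : (Fin n → Fin k) × (Fin n → Fin l) => (mapsGraph p.1 p.2).mult)
      (fun p hp => (mem_filter.1 hp).2), mul_sum]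
  refine sum_congr rfl fun μ hμ => ?_
  have h3 : ∀ p ∈ (univ.filter fun p : (Fin n → Fin k) × (Fin n → Fin l) =>
      (mapsGraph p.1 p.2).mult ∈ multFinset n k l).filter
        (fun p => (mapsGraph p.1 p.2).mult = μ),
      graphTerm S G ħ (mapsGraph p.1 p.2) *
        ((∏ b, ∏ w, ((mapsGraph p.1 p.2).mult b w).factorial : ℕ) : ℂ) =
      graphTerm S G ħ ⟨k, l, μ⟩ * ((∏ b, ∏ w, (μ b w).factorial : ℕ) : ℂ) := by
    intro p hp
    have hp' : (mapsGraph p.1 p.2).mult = μ := (mem_filter.1 hp).2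
    subst hp'
    rfl
  have h4 : (univ.filter fun p : (Fin n → Fin k) × (Fin n → Fin l) =>
      (mapsGraph p.1 p.2).mult ∈ multFinset n k l).filter
        (fun p => (mapsGraph p.1 p.2).mult = μ) =
      univ.filter fun p => (mapsGraph p.1 p.2).mult = μ := by
    rw [filter_filter]
    exact filter_congr fun p _ => ⟨fun h => h.2, fun h => ⟨by rw [h]; exact hμ, h⟩⟩
  rw [sum_congr rfl h3, h4, sum_const, nsmul_eq_mul,
    ← card_mapsGraph_eq μ (mem_multFinset.1 hμ).2.2]
  push_cast
  ring

/-- The sums over connected graphs with labelled edges are sums over graphs with labelled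
vertices. -/
theorem coeff_labelSeries_connWeight (hS : S.Symmetric) (hG : ContDiff ℝ ∞ G) {ħ : ℝ}
    (hħ : 0 < ħ) {n : ℕ} (hn : n ≠ 0) :
    PowerSeries.coeff n (labelSeries (connWeight S G ħ)) =
      ∑ γ ∈ labelledGraphs n, graphTerm S G ħ γ / (γ.nB.factorial * γ.nW.factorial : ℂ) := by
  classical
  have hN : Fintype.card (Fin n) < n + 2 := by rw [Fintype.card_fin]; omega
  have h1 : labelSum (connWeight S G ħ) n = ∑ k ∈ range (n + 2), ∑ l ∈ range (n + 2),
      (k.factorial : ℂ)⁻¹ * ((l.factorial : ℂ)⁻¹ *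
        (n.factorial * ∑ μ ∈ multFinset n k l, graphTerm S G ħ ⟨k, l, μ⟩)) := by
    simp only [labelSum, connWeight, connSum, mul_sum _ _ (((ħ : ℂ) / Complex.I) ^ _), card_univ,
      Fintype.card_fin]
    -- Labelling the blocks of the two partitions turns them into surjections and introduces `1/k!`
    -- and `1/l!`.
    rw [sum_comm, connPairs, sum_filter, sum_product, sum_setPartitions_eq _ hN]
    refine sum_congr rfl fun k _ => ?_
    simp only [sum_setPartitions_eq (α := Fin n) _ hN]
    rw [sum_comm, mul_sum]
    refine sum_congr rfl fun l _ => ?_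
    rw [← mul_sum, sum_maps_eq_sum_mult hS hG hħ hn]
  rw [labelSeries, PowerSeries.coeff_mk, h1, sum_labelledGraphs, Algebra.smul_def, mul_sum]
  refine sum_congr rfl fun k _ => ?_
  rw [mul_sum]
  refine sum_congr rfl fun l _ => ?_
  change _ = ∑ μ ∈ multFinset n k l, graphTerm S G ħ ⟨k, l, μ⟩ / (k.factorial * l.factorial : ℂ)
  rw [← sum_div]
  have hk : (k.factorial : ℂ) ≠ 0 := by exact_mod_cast k.factorial_ne_zero
  have hl : (l.factorial : ℂ) ≠ 0 := by exact_mod_cast l.factorial_ne_zero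
  have hn' : (n.factorial : ℂ) ≠ 0 := by exact_mod_cast n.factorial_ne_zero
  simp only [eq_ratCast]
  push_cast
  field_simp

theorem coeff_graphSeries (hS : S.Symmetric) (hG : ContDiff ℝ ∞ G) (ħ : ℝ) (n : ℕ) :
    PowerSeries.coeff n ((Complex.I / (ħ : ℂ)) • graphSeries S G ħ) =
      ∑ γ ∈ labelledGraphs n, graphTerm S G ħ γ / (γ.nB.factorial * γ.nW.factorial : ℂ) := by
  rw [← finsum_isoClass_eq n _ fun _ _ => graphTerm_iso hS hG ħ, PowerSeries.coeff_smul,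
    graphSeries, PowerSeries.coeff_mk,
    finsum_mem_eq_finite_toFinset_sum _ (finite_isoClass n),
    finsum_mem_eq_finite_toFinset_sum _ (finite_isoClass n), smul_eq_mul, mul_sum]
  refine sum_congr rfl fun c _ => ?_
  rw [graphTerm, mul_div_assoc, mul_div_assoc, mul_div_assoc]

/-- An isolated black vertex is admissible, since its degree is `0` and only degree `1` is
forbidden. -/
theorem labelledGraphs_zero [DecidableEq BipGraph] :
    labelledGraphs 0 = {mapsGraph (Fin.elim0 : Fin 0 → Fin 1) (Fin.elim0 : Fin 0 → Fin 0),
      mapsGraph (Fin.elim0 : Fin 0 → Fin 0) (Fin.elim0 : Fin 0 → Fin 1)} := by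
  ext γ
  rw [mem_labelledGraphs, mem_insert, mem_singleton]
  constructor
  · rintro ⟨h1, -, h3⟩
    obtain ⟨k, l, μ⟩ := γ
    rcases h1.of_numEdges_eq_zero h3 with ⟨hk, hl⟩ | ⟨hk, hl⟩
    · simp only at hk hl
      subst hk hl
      left
      simp only [mapsGraph, BipGraph.mk.injEq, heq_eq_eq, true_and]
      funext b w
      exact w.elim0
    · simp only at hk hl
      subst hk hl
      right
      simp only [mapsGraph, BipGraph.mk.injEq, heq_eq_eq, true_and]
      funext b
      exact b.elim0
  · have hdeg : ∀ {k l : ℕ} (f : Fin 0 → Fin k) (g : Fin 0 → Fin l),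
        (mapsGraph f g).WhiteLeaved := by
      intro k l f g b
      rw [blackDeg_mapsGraph]
      simp
    rintro (rfl | rfl)
    · refine ⟨?_, hdeg _ _, numEdges_mapsGraph _ _⟩
      have : Nonempty (Fin 1 ⊕ Fin 0) := ⟨Sum.inl 0⟩
      have : Subsingleton (Fin 1 ⊕ Fin 0) := (Equiv.sumEmpty (Fin 1) (Fin 0)).subsingleton
      exact ⟨fun u v => by rw [Subsingleton.elim u v]⟩
    · refine ⟨?_, hdeg _ _, numEdges_mapsGraph _ _⟩
      have : Nonempty (Fin 0 ⊕ Fin 1) := ⟨Sum.inr 0⟩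
      have : Subsingleton (Fin 0 ⊕ Fin 1) := (Equiv.emptySum (Fin 0) (Fin 1)).subsingleton
      exact ⟨fun u v => by rw [Subsingleton.elim u v]⟩

theorem component_of_isEmpty {T : Coeffs d} (hT : T.Symmetric) {E : Type} [Fintype E] [IsEmpty E]
    (a : E → Fin d) : component T a = T 0 Fin.elim0 := by
  rw [component_eq hT a (Equiv.equivOfIsEmpty (Fin 0) E)]
  congr 1
  exact Subsingleton.elim _ _

/-- Degree zero needs its own computation: pairs of partitions of the empty set see only the empty
graph, while the exponent contains the isolated vertices. -/
theorem constantCoeff_graphSeries (hS : S.Symmetric) (hG : ContDiff ℝ ∞ G) (ħ : ℝ) :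
    PowerSeries.constantCoeff ((Complex.I / (ħ : ℂ)) • graphSeries S G ħ) =
      Complex.I / ħ * (S.zeroth + G S.phi) := by
  classical
  rw [← PowerSeries.coeff_zero_eq_constantCoeff_apply, coeff_graphSeries hS hG,
    labelledGraphs_zero, sum_pair (by simp [mapsGraph])]
  have h1 : contraction S G (mapsGraph (Fin.elim0 : Fin 0 → Fin 1) (Fin.elim0 : Fin 0 → Fin 0)) =
      S.zeroth := by
    have := prod_factorial_mul_contraction_mapsGraph hS hG (Fin.elim0 : Fin 0 → Fin 1)
      (Fin.elim0 : Fin 0 → Fin 0)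
    simpa [component_of_isEmpty hS, Coeffs.zeroth] using this
  have h2 : contraction S G (mapsGraph (Fin.elim0 : Fin 0 → Fin 0) (Fin.elim0 : Fin 0 → Fin 1)) =
      G S.phi := by
    have := prod_factorial_mul_contraction_mapsGraph hS hG (Fin.elim0 : Fin 0 → Fin 0)
      (Fin.elim0 : Fin 0 → Fin 1)
    simpa [component_of_isEmpty (partials_symmetric hG _), partials] using this
  simp only [graphTerm, h1, h2, BipGraph.loopNumber, numEdges_mapsGraph]
  simp
  ring

end Contraction

end QuantumThick

end

theorem proposition2 (d : ℕ) (S : QuantumThick.Coeffs d) (hS : S.Symmetric)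
    (G : EuclideanSpace ℝ (Fin d) → ℝ) (hG : ContDiff ℝ ∞ G) (ħ : ℝ) (hħ : 0 < ħ) :
    (∀ n : ℕ, {c : QuantumThick.IsoClass | c.rep.numEdges = n}.Finite) ∧
      QuantumThick.IsFormalIntegral S G ħ
        (QuantumThick.expSeries
          ((Complex.I / (ħ : ℂ)) • QuantumThick.graphSeries S G ħ)) := by
  refine ⟨QuantumThick.finite_isoClass, fun n => ?_⟩
  rw [QuantumThick.coeff_expSeries hS hG (QuantumThick.constantCoeff_graphSeries hS hG ħ)
    fun m => ?_]
  · exact QuantumThick.hasOscIntegral_amplitude hS hG hħ n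
  · rw [QuantumThick.coeff_graphSeries hS hG,
      QuantumThick.coeff_labelSeries_connWeight hS hG hħ m.succ_ne_zero]
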